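/- All graphs are simple; a graph is countable if its vertex set is finite or countably infinite. A ray is a one-way infinite path. Two rays of a graph $G$ are vertex-equivalent (edge-equivalent) if for every finite set $S$ of vertices (of edges) some component of $G-S$ contains tails of both; the equivalence classes are the vertex-ends (edge-ends) of $G$. View $G$ as a 1-complex, each edge being a copy of $[0,1]$. $\mathrm{ETOP}'(G)$ is the set of all points of $G$ and all edge-ends of $G$, with the topology generated by (i) the subsets of the interior of an edge that correspond to open subsets of $(0,1)$, and (ii) for every finite edge set $S$ and every component $C$ of $G-S$, all sets $C\cup\Omega'(C)\cup E'(C)$, where $\Omega'(C)$ is the set of edge-ends having a ray in $C$ and $E'(C)$ is any union of half-edges $(z,y]$, with $z$ an inner point of $e$, one for every edge $e=xy\in S$ and each endpoint $y$ of $e$ in $C$. $\mathrm{ETOP}(G)$ is obtained from $\mathrm{ETOP}'(G)$ by identifying any two points that have the same open neighbourhoods. A topological Euler tour of $\mathrm{ETOP}(G)$ is a continuous map $\sigma:S^1\to\mathrm{ETOP}(G)$ that traverses each edge exactly once, i.e. such that every inner point of an edge is the image of exactly one point of $S^1$. $\mathrm{MTOP}(G)$ is the set of all points of $G$ and all vertex-ends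 of $G$, with the topology generated by (i) the subsets of the interior of an edge that correspond to open subsets of $(0,1)$, (ii) the open stars of radius $\varepsilon$ around vertices, $0<\varepsilon<1$, and (iii) for every vertex-end $\omega$, finite vertex set $S$ and $0<\varepsilon<1$, the set $C\cup\Omega(S,\omega)\cup E_\varepsilon(S,\omega)$, where $C$ is the component of $G-S$ containing a ray of $\omega$, $\Omega(S,\omega)$ is the set of vertex-ends having a ray in $C$, and $E_\varepsilon(S,\omega)$ is the set of inner points of edges between $S$ and $C$ at distance less than $\varepsilon$ from their endpoint in $C$. A Hamilton circle of $\mathrm{MTOP}(G)$ is a subspace homeomorphic to $S^1$ that contains all vertices of $G$. The line graph $L(G)$ has vertex set $E(G)$, two distinct edges of $G$ being adjacent in $L(G)$ if they share an endpoint. Theorem 1.4. Let $G$ be a countable graph with at least one edge such that $\mathrm{ETOP}(G)$ has a topological Euler tour. Then $\mathrm{MTOP}(L(G))$ has a Hamilton circle. -/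

import Mathlib

open Set Filter Topology

universe u

namespace InfGraph

variable {V : Type u}

/-- A ray in `G`: a one-way infinite path, given by its sequence of (distinct) vertices. -/
structure Ray (G : SimpleGraph V) where
  vert : ℕ → V
  inj : Function.Injective vert
  adj : ∀ n, G.Adj (vert n) (vert (n + 1))

/-- The component `C` of `G - S` (`S` a set of vertices) contains a tail of the ray `R`. -/
def Ray.TailInV {G : SimpleGraph V} (R : Ray G) {S : Set V} (C : G.ComponentCompl S) : Prop :=
  ∀ᶠ n in atTop, R.vert n ∈ C

/-- The component `C` of `G - S` (`S` a set of edges) contains a tail of the ray `R`. For finite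
`S` this is just the condition on vertices, since only finitely many edges of `R` lie in `S`. -/
def Ray.TailInE {G : SimpleGraph V} (R : Ray G) {S : Set (Sym2 V)}
    (C : (G.deleteEdges S).ConnectedComponent) : Prop :=
  ∀ᶠ n in atTop, R.vert n ∈ C.supp

theorem Ray.exists_tailInV {G : SimpleGraph V} (R : Ray G) {S : Set V} (hS : S.Finite) :
    ∃ C : G.ComponentCompl S, R.TailInV C := by
  have h : ∀ᶠ n in atTop, R.vert n ∉ S := by
    have := R.inj.tendsto_cofinite.eventually hS.eventually_cofinite_notMem
    rwa [Nat.cofinite_eq_atTop] at this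
  obtain ⟨N, hN⟩ := eventually_atTop.1 h
  refine ⟨G.componentComplMk (hN N le_rfl), eventually_atTop.2 ⟨N, fun n hn => ?_⟩⟩
  induction n, hn using Nat.le_induction with
  | base => exact G.componentComplMk_mem _
  | succ n hn ih =>
    exact SimpleGraph.ComponentCompl.mem_of_adj _ _ ih (hN (n + 1) (by omega)) (R.adj n)

theorem Ray.tailInV_unique {G : SimpleGraph V} (R : Ray G) {S : Set V}
    {C D : G.ComponentCompl S} (hC : R.TailInV C) (hD : R.TailInV D) : C = D := by
  obtain ⟨n, ⟨_, h1⟩, ⟨_, h2⟩⟩ := (Filter.Eventually.and hC hD).exists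
  exact h1.symm.trans h2

theorem Ray.edge_inj {G : SimpleGraph V} (R : Ray G) :
    Function.Injective fun n => s(R.vert n, R.vert (n + 1)) := by
  intro m n h
  rcases Sym2.eq_iff.1 h with ⟨h1, _⟩ | ⟨h1, h2⟩
  · exact R.inj h1
  · have h1 := R.inj h1
    have h2 := R.inj h2
    omega

theorem Ray.exists_tailInE {G : SimpleGraph V} (R : Ray G) {S : Set (Sym2 V)} (hS : S.Finite) :
    ∃ C : (G.deleteEdges S).ConnectedComponent, R.TailInE C := by
  have h : ∀ᶠ n in atTop, s(R.vert n, R.vert (n + 1)) ∉ S := by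
    have := R.edge_inj.tendsto_cofinite.eventually hS.eventually_cofinite_notMem
    rwa [Nat.cofinite_eq_atTop] at this
  obtain ⟨N, hN⟩ := eventually_atTop.1 h
  refine ⟨(G.deleteEdges S).connectedComponentMk (R.vert N),
    eventually_atTop.2 ⟨N, fun n hn => ?_⟩⟩
  induction n, hn using Nat.le_induction with
  | base => rfl
  | succ n hn ih =>
    have ha : (G.deleteEdges S).Adj (R.vert n) (R.vert (n + 1)) :=
      SimpleGraph.deleteEdges_adj.2 ⟨R.adj n, hN n hn⟩
    exact (SimpleGraph.ConnectedComponent.eq.2 ha.symm.reachable).trans ih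

theorem Ray.tailInE_unique {G : SimpleGraph V} (R : Ray G) {S : Set (Sym2 V)}
    {C D : (G.deleteEdges S).ConnectedComponent} (hC : R.TailInE C) (hD : R.TailInE D) :
    C = D := by
  obtain ⟨n, h1, h2⟩ := (Filter.Eventually.and hC hD).exists
  exact (SimpleGraph.ConnectedComponent.mem_supp_iff _ _).1 h1 |>.symm.trans
    ((SimpleGraph.ConnectedComponent.mem_supp_iff _ _).1 h2)

/-- Two rays are vertex-equivalent if no finite set of vertices separates them: for every finite
`S`, some component of `G - S` contains tails of both. -/
def vertexSetoid (G : SimpleGraph V) : Setoid (Ray G) where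
  r R L := ∀ S : Set V, S.Finite → ∃ C : G.ComponentCompl S, R.TailInV C ∧ L.TailInV C
  iseqv :=
    { refl := fun R S hS => (R.exists_tailInV hS).imp fun _ h => ⟨h, h⟩
      symm := fun h S hS => (h S hS).imp fun _ hC => hC.symm
      trans := fun {R L M} h₁ h₂ S hS => by
        obtain ⟨C, hC⟩ := h₁ S hS
        obtain ⟨D, hD⟩ := h₂ S hS
        obtain rfl := L.tailInV_unique hC.2 hD.1
        exact ⟨C, hC.1, hD.2⟩ }

/-- Two rays are edge-equivalent if no finite set of edges separates them: for every finite
set `S` of edges, some component of `G - S` contains tails of both. -/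
def edgeSetoid (G : SimpleGraph V) : Setoid (Ray G) where
  r R L := ∀ S : Set (Sym2 V), S ⊆ G.edgeSet → S.Finite →
    ∃ C : (G.deleteEdges S).ConnectedComponent, R.TailInE C ∧ L.TailInE C
  iseqv :=
    { refl := fun R S _ hS => (R.exists_tailInE hS).imp fun _ h => ⟨h, h⟩
      symm := fun h S hSG hS => (h S hSG hS).imp fun _ hC => hC.symm
      trans := fun {R L M} h₁ h₂ S hSG hS => by
        obtain ⟨C, hC⟩ := h₁ S hSG hS
        obtain ⟨D, hD⟩ := h₂ S hSG hS
        obtain rfl := L.tailInE_unique hC.2 hD.1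
        exact ⟨C, hC.1, hD.2⟩ }

/-- The vertex-ends of `G`. -/
def VertexEnd (G : SimpleGraph V) : Type u := Quotient (vertexSetoid G)

/-- The edge-ends of `G`. -/
def EdgeEnd (G : SimpleGraph V) : Type u := Quotient (edgeSetoid G)

/-- The vertex-end to which a ray belongs. -/
def VertexEnd.mk {G : SimpleGraph V} (R : Ray G) : VertexEnd G := Quotient.mk (vertexSetoid G) R

/-- The edge-end to which a ray belongs. -/
def EdgeEnd.mk {G : SimpleGraph V} (R : Ray G) : EdgeEnd G := Quotient.mk (edgeSetoid G) R

/-- The point set consisting of `G`, viewed as a 1-complex, together with a set `Ω` of ends.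
Each edge `e` is a copy of `[0, 1]`, with `0` and `1` glued to the two endpoints of `e`; which
endpoint is at `0` is fixed by a choice, namely the ordered pair `e.out`. -/
inductive Pt (G : SimpleGraph V) (Ω : Type u) : Type u
  | vertex (v : V) : Pt G Ω
  | inner (e : G.edgeSet) (t : Ioo (0 : ℝ) 1) : Pt G Ω
  | endPt (ω : Ω) : Pt G Ω

open Classical in
/-- The distance, inside the edge `e`, between its inner point with parameter `t` and its
endpoint `y` (only used when `y ∈ e`). -/
noncomputable def distIn {G : SimpleGraph V} (e : G.edgeSet) (t : Ioo (0 : ℝ) 1) (y : V) : ℝ :=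
  if y = (Quot.out (e : Sym2 V)).1 then (t : ℝ) else 1 - (t : ℝ)

/-- The sets of inner points of an edge that correspond to open subsets of `(0, 1)`. -/
def innerOpens (G : SimpleGraph V) (Ω : Type u) : Set (Set (Pt G Ω)) :=
  {U | ∃ (e : G.edgeSet) (I : Set (Ioo (0 : ℝ) 1)), IsOpen I ∧ U = Pt.inner e '' I}

/-! ### The topology `ETOP` -/

/-- The set `C ∪ Ω'(C) ∪ E'(C)`, where `C` is a component (as a 1-complex) of `G - S`, `Ω'(C)` is
the set of edge-ends having a ray in `C`, and `E'(C)` consists of the half-open half-edges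
`(z, y]`, where `e = xy ∈ S`, `y ∈ C`, and `z` is the inner point of `e` at distance `r e y`
from `y`. -/
def etopBasic (G : SimpleGraph V) (S : Set (Sym2 V)) (C : (G.deleteEdges S).ConnectedComponent)
    (r : G.edgeSet → V → ℝ) : Set (Pt G (EdgeEnd G)) :=
  {p | match p with
    | Pt.vertex v => v ∈ C.supp
    | Pt.inner e t =>
        ((e : Sym2 V) ∉ S ∧ ∃ y ∈ (e : Sym2 V), y ∈ C.supp) ∨
        ((e : Sym2 V) ∈ S ∧ ∃ y ∈ (e : Sym2 V), y ∈ C.supp ∧ distIn e t y < r e y)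
    | Pt.endPt ω => ∃ R : Ray G, EdgeEnd.mk R = ω ∧ R.TailInE C}

/-- `ETOP'(G)`: the 1-complex `G` together with its edge-ends. -/
abbrev ETOP' (G : SimpleGraph V) : Type u := Pt G (EdgeEnd G)

instance instTopETOP' (G : SimpleGraph V) : TopologicalSpace (Pt G (EdgeEnd G)) :=
  TopologicalSpace.generateFrom
    (innerOpens G (EdgeEnd G) ∪
      {U | ∃ (S : Set (Sym2 V)) (C : (G.deleteEdges S).ConnectedComponent)
          (r : G.edgeSet → V → ℝ),
        S ⊆ G.edgeSet ∧ S.Finite ∧ (∀ e y, r e y ∈ Ioo (0 : ℝ) 1) ∧ U = etopBasic G S C r})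

/-- `ETOP(G)`: obtained from `ETOP'(G)` by identifying any two points with the same open
neighbourhoods. -/
abbrev ETOP (G : SimpleGraph V) : Type u := SeparationQuotient (ETOP' G)

/-- A topological Euler tour in `ETOP(G)`: a continuous map from the circle that traverses every
edge exactly once, that is, every inner point of an edge is the image of exactly one point. -/
def IsTopologicalEulerTour (G : SimpleGraph V) (σ : Circle → ETOP G) : Prop :=
  Continuous σ ∧
    ∀ (e : G.edgeSet) (t : Ioo (0 : ℝ) 1),
      ∃! x : Circle, σ x = SeparationQuotient.mk (Pt.inner e t : ETOP' G)

/-! ### The topology `MTOP` -/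

/-- The open star of radius `ε` around the vertex `v`. -/
def openStar (G : SimpleGraph V) (v : V) (ε : ℝ) : Set (Pt G (VertexEnd G)) :=
  {p | match p with
    | Pt.vertex w => w = v
    | Pt.inner e t => v ∈ (e : Sym2 V) ∧ distIn e t v < ε
    | Pt.endPt _ => False}

/-- The set `C ∪ Ω(C) ∪ E_ε(S, C)`, where `C` is a component (as a 1-complex) of `G - S`, `Ω(C)`
is the set of vertex-ends having a ray in `C`, and `E_ε(S, C)` is the set of inner points of
`S`–`C` edges at distance less than `ε` from their endpoint in `C`. -/
def mtopBasic (G : SimpleGraph V) (S : Set V) (C : G.ComponentCompl S) (ε : ℝ) :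
    Set (Pt G (VertexEnd G)) :=
  {p | match p with
    | Pt.vertex v => v ∈ C
    | Pt.inner e t =>
        (∀ y ∈ (e : Sym2 V), y ∈ C) ∨
        (∃ x y, (e : Sym2 V) = s(x, y) ∧ x ∈ S ∧ y ∈ C ∧ distIn e t y < ε)
    | Pt.endPt ω => ∃ R : Ray G, VertexEnd.mk R = ω ∧ R.TailInV C}

/-- `MTOP(G)`: the 1-complex `G` together with its vertex-ends. -/
abbrev MTOP (G : SimpleGraph V) : Type u := Pt G (VertexEnd G)

/-- The topology of `MTOP(G)`. The basic sets around a vertex-end, that of a ray `R`, are given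
by the component of `G - S` that contains a tail of `R`. -/
instance instTopMTOP (G : SimpleGraph V) : TopologicalSpace (Pt G (VertexEnd G)) :=
  TopologicalSpace.generateFrom
    (innerOpens G (VertexEnd G) ∪
      {U | ∃ (v : V) (ε : ℝ), 0 < ε ∧ ε < 1 ∧ U = openStar G v ε} ∪
      {U | ∃ (S : Set V) (R : Ray G) (C : G.ComponentCompl S) (ε : ℝ),
        S.Finite ∧ R.TailInV C ∧ 0 < ε ∧ ε < 1 ∧ U = mtopBasic G S C ε})

/-- A circle in `X`: a homeomorphic copy of the unit circle. -/
def IsCircle {X : Type u} [TopologicalSpace X] (H : Set X) : Prop :=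
  Nonempty (Circle ≃ₜ H)

/-- A Hamilton circle of `MTOP(G)`: a circle containing all vertices of `G`. -/
def IsHamiltonCircle (G : SimpleGraph V) (H : Set (MTOP G)) : Prop :=
  IsCircle H ∧ ∀ v : V, (Pt.vertex v : MTOP G) ∈ H

end InfGraph

/-! The tour enters only through two consequences: all edges of `G` lie in one component, and every
finite cut of `G` is even. Both come from a continuous potential on `ETOP'(G)` attached to a finite
cut, equal to `1/2` and `-1/2` on the two sides and linear across the cut edges. Along the closed
tour it changes sign exactly once for each cut edge (`IsTopologicalEulerTour.evenCuts`,
`IsTopologicalEulerTour.reachable`).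

The Hamilton circle is then built from parity alone, by successive refinement in the manner of
Fleury's algorithm. A `Gap` is a missing piece: a connected subgraph `C` to be traversed from `x` to
`y`, whose finite cuts are even exactly when they do not separate `x` from `y` (`EvenCuts`).
Removing an edge `xz` preserves this condition with `z` in place of `x`, so `y` stays in the
component of `z`. If `xz` is a bridge, any edges left at `x` form a gap of their own, to be filled
by a closed trail. So the gap from `ex` to `ey` splits at the new edge `xz` into two cells. A cell
with nothing left to insert is an edge of `L(G)`, because its two end edges share a vertex. Halving
`[0, 1]` accordingly, each parameter ends up in an edge of `L(G)` or follows an infinite branch of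
nested gaps, and is then sent to a vertex-end of `L(G)` (`val`).

Two choices make the limit work. The edge `xz` leads towards the missing edge that is first in an
enumeration of the edges (this is where countability enters), so no edge stays missing along a
branch forever (`Gap.wellFounded_child`). And whenever this target is inserted, the right-hand cell
is reversed, so that both end edges of the gaps are replaced again and again along every branch
(`Gap.exists_ne_ends`).

The edges of a gap induce a connected subgraph of `L(G)`, which only finitely many outside vertices
of `L(G)` are adjacent to. Connectedness yields a ray inside the nested gaps and, with the changing
end edges, continuity at ends (`contAt_of_branch`). Finite separation keeps the ends of disjoint
gaps distinct and gives injectivity (`val_eq_of_expanding`). Since `MTOP` is Hausdorff, a closed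
curve that is injective up to its endpoints is a circle. -/

namespace InfGraph

variable {V : Type u}

/-! ### Points of edges and arcs -/

theorem distIn_pos {G : SimpleGraph V} (e : G.edgeSet) (t : Ioo (0 : ℝ) 1) (y : V) :
    0 < distIn e t y := by
  unfold distIn
  split_ifs
  · exact t.2.1
  · linarith [t.2.2]

theorem distIn_lt_one {G : SimpleGraph V} (e : G.edgeSet) (t : Ioo (0 : ℝ) 1) (y : V) :
    distIn e t y < 1 := by
  unfold distIn
  split_ifs
  · exact t.2.2
  · linarith [t.2.1]

theorem distIn_injective {G : SimpleGraph V} (e : G.edgeSet) (y : V) :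
    Function.Injective fun t => distIn e t y := by
  intro t t' h
  simp only [distIn] at h
  split_ifs at h
  · exact Subtype.ext h
  · exact Subtype.ext (by linarith)

theorem continuous_distIn {G : SimpleGraph V} (e : G.edgeSet) (y : V) :
    Continuous fun t => distIn e t y := by
  unfold distIn
  split_ifs <;> fun_prop

theorem distIn_add_distIn {G : SimpleGraph V} (e : G.edgeSet) (t : Ioo (0 : ℝ) 1) {a b : V}
    (h : (e : Sym2 V) = s(a, b)) (hab : a ≠ b) : distIn e t a + distIn e t b = 1 := by
  have h1 : s((Quot.out (e : Sym2 V)).1, (Quot.out (e : Sym2 V)).2) = s(a, b) :=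
    (Quot.out_eq (e : Sym2 V)).trans h
  unfold distIn
  rcases Sym2.eq_iff.1 h1 with ⟨h2, -⟩ | ⟨h2, -⟩
  · rw [h2, if_pos rfl, if_neg hab.symm]; ring
  · rw [h2, if_pos rfl, if_neg hab]; ring

theorem exists_distIn_eq {G : SimpleGraph V} (e : G.edgeSet) (y : V) {s : ℝ} (hs : s ∈ Ioo (0 : ℝ) 1) :
    ∃ t, distIn e t y = s := by
  by_cases h : y = (Quot.out (e : Sym2 V)).1
  · exact ⟨⟨s, hs⟩, by simp [distIn, h]⟩
  · exact ⟨⟨1 - s, by linarith [hs.2], by linarith [hs.1]⟩, by simp [distIn, h]⟩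

open Classical in
/-- The edge from `a` to `b`, traversed from `a` (parameter `0`) to `b` (parameter `1`). -/
noncomputable def arc {G : SimpleGraph V} {Ω : Type u} {a b : V} (h : G.Adj a b) (s : ℝ) : Pt G Ω :=
  if hs : s ∈ Ioo (0 : ℝ) 1 then
    Pt.inner ⟨s(a, b), h⟩ (exists_distIn_eq (G := G) ⟨s(a, b), h⟩ a hs).choose
  else if s ≤ 0 then Pt.vertex a else Pt.vertex b

section Arc

variable {G : SimpleGraph V} {Ω : Type u} {a b : V}

theorem arc_of_le_zero (h : G.Adj a b) {s : ℝ} (hs : s ≤ 0) :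
    (arc h s : Pt G Ω) = Pt.vertex a := by
  rw [arc, dif_neg (fun hh => absurd hh.1 (not_lt.2 hs)), if_pos hs]

theorem arc_of_one_le (h : G.Adj a b) {s : ℝ} (hs : 1 ≤ s) :
    (arc h s : Pt G Ω) = Pt.vertex b := by
  rw [arc, dif_neg (fun hh => absurd hh.2 (not_lt.2 hs)), if_neg (by linarith)]

theorem arc_of_mem (h : G.Adj a b) {s : ℝ} (hs : s ∈ Ioo (0 : ℝ) 1) :
    ∃ t, (arc h s : Pt G Ω) = Pt.inner ⟨s(a, b), h⟩ t ∧ distIn (G := G) ⟨s(a, b), h⟩ t a = s ∧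
      distIn (G := G) ⟨s(a, b), h⟩ t b = 1 - s := by
  have h1 := (exists_distIn_eq (G := G) ⟨s(a, b), h⟩ a hs).choose_spec
  refine ⟨_, by rw [arc, dif_pos hs], h1, ?_⟩
  have := distIn_add_distIn (G := G) ⟨s(a, b), h⟩
    (exists_distIn_eq (G := G) ⟨s(a, b), h⟩ a hs).choose rfl h.ne
  linarith

theorem arc_zero (h : G.Adj a b) : (arc h 0 : Pt G Ω) = Pt.vertex a := arc_of_le_zero h le_rfl

theorem arc_one (h : G.Adj a b) : (arc h 1 : Pt G Ω) = Pt.vertex b := arc_of_one_le h le_rfl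

theorem arc_injOn (h : G.Adj a b) : InjOn (arc h : ℝ → Pt G Ω) (Icc 0 1) := by
  have key : ∀ s ∈ Icc (0 : ℝ) 1, s = 0 ∧ (arc h s : Pt G Ω) = Pt.vertex a ∨
      s = 1 ∧ (arc h s : Pt G Ω) = Pt.vertex b ∨
      ∃ t, (arc h s : Pt G Ω) = Pt.inner ⟨s(a, b), h⟩ t ∧
        distIn (G := G) ⟨s(a, b), h⟩ t a = s := by
    intro s hs
    rcases hs.1.eq_or_lt with h0 | h0
    · exact Or.inl ⟨h0.symm, h0 ▸ arc_zero h⟩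
    rcases hs.2.eq_or_lt with h1 | h1
    · exact Or.inr (Or.inl ⟨h1, h1 ▸ arc_one h⟩)
    obtain ⟨t, ht, hd, -⟩ := arc_of_mem (Ω := Ω) h ⟨h0, h1⟩
    exact Or.inr (Or.inr ⟨t, ht, hd⟩)
  have hne := h.ne
  intro s hs s' hs' heq
  rcases key s hs with ⟨h1, h2⟩ | ⟨h1, h2⟩ | ⟨t, h2, h3⟩ <;>
    rcases key s' hs' with ⟨h1', h2'⟩ | ⟨h1', h2'⟩ | ⟨t', h2', h3'⟩ <;>
    rw [h2, h2'] at heq <;> simp_all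

end Arc

/-! ### The topology `MTOP` is Hausdorff, and arcs are continuous -/

section MTOP

variable {G : SimpleGraph V}

theorem isOpen_image_inner (e : G.edgeSet) {I : Set (Ioo (0 : ℝ) 1)} (hI : IsOpen I) :
    IsOpen (Pt.inner e '' I : Set (MTOP G)) :=
  TopologicalSpace.isOpen_generateFrom_of_mem (Or.inl (Or.inl ⟨e, I, hI, rfl⟩))

theorem isOpen_openStar (v : V) {ε : ℝ} (h0 : 0 < ε) (h1 : ε < 1) : IsOpen (openStar G v ε) :=
  TopologicalSpace.isOpen_generateFrom_of_mem (Or.inl (Or.inr ⟨v, ε, h0, h1, rfl⟩))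

theorem isOpen_mtopBasic {S : Set V} (hS : S.Finite) {R : Ray G} {C : G.ComponentCompl S}
    (hR : R.TailInV C) {ε : ℝ} (h0 : 0 < ε) (h1 : ε < 1) : IsOpen (mtopBasic G S C ε) :=
  TopologicalSpace.isOpen_generateFrom_of_mem (Or.inr ⟨S, R, C, ε, hS, hR, h0, h1, rfl⟩)

theorem componentCompl_eq_of_mem {S : Set V} {C D : G.ComponentCompl S} {v : V} (hC : v ∈ C)
    (hD : v ∈ D) : C = D := by
  obtain ⟨_, h1⟩ := hC
  obtain ⟨_, h2⟩ := hD
  exact h1.symm.trans h2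

theorem sep_vertex_vertex {v w : V} (h : v ≠ w) :
    SeparatedNhds ({Pt.vertex v} : Set (MTOP G)) {Pt.vertex w} := by
  refine ⟨openStar G v (1 / 2), openStar G w (1 / 2), isOpen_openStar _ (by norm_num) (by norm_num),
    isOpen_openStar _ (by norm_num) (by norm_num), by simp [openStar], by simp [openStar], ?_⟩
  rw [Set.disjoint_left]
  rintro (u | ⟨e, t⟩ | ω) h1 h2
  · exact h (Eq.trans (Eq.symm h1) h2)
  · have := distIn_add_distIn e t ((Sym2.mem_and_mem_iff h).1 ⟨h1.1, h2.1⟩) h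
    linarith [h1.2, h2.2]
  · exact h1

theorem sep_vertex_inner (v : V) (e : G.edgeSet) (t : Ioo (0 : ℝ) 1) :
    SeparatedNhds ({Pt.vertex v} : Set (MTOP G)) {Pt.inner e t} := by
  have hp := distIn_pos e t v
  have hl := distIn_lt_one e t v
  refine ⟨openStar G v (distIn e t v / 2), Pt.inner e '' {t' | distIn e t v / 2 < distIn e t' v},
    isOpen_openStar _ (by linarith) (by linarith),
    isOpen_image_inner _ (isOpen_lt continuous_const (continuous_distIn e v)),
    by simp [openStar], ?_, ?_⟩
  · rw [Set.singleton_subset_iff]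
    exact ⟨t, by simpa using hp, rfl⟩
  · rw [Set.disjoint_right]
    rintro _ ⟨t', h1, rfl⟩ h2
    exact lt_asymm h1 h2.2

theorem sep_vertex_end (v : V) (R : Ray G) :
    SeparatedNhds ({Pt.vertex v} : Set (MTOP G)) {Pt.endPt (VertexEnd.mk R)} := by
  obtain ⟨C, hC⟩ := R.exists_tailInV (finite_singleton v)
  have hv : v ∉ C := fun h => C.notMem_of_mem h rfl
  refine ⟨openStar G v (1 / 2), mtopBasic G {v} C (1 / 2),
    isOpen_openStar _ (by norm_num) (by norm_num),
    isOpen_mtopBasic (finite_singleton v) hC (by norm_num) (by norm_num), by simp [openStar], ?_, ?_⟩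
  · rw [Set.singleton_subset_iff]
    exact ⟨R, rfl, hC⟩
  · rw [Set.disjoint_left]
    rintro (u | ⟨e, t⟩ | ω) h1 h2
    · exact hv (Eq.subst (motive := (· ∈ C)) h1 h2)
    · rcases h2 with h2 | ⟨x, y, hxy, hx, hy, hd⟩
      · exact hv (h2 v h1.1)
      · obtain rfl : x = v := hx
        have hne : x ≠ y := fun h => hv (h ▸ hy)
        have := distIn_add_distIn e t hxy hne
        linarith [h1.2]
    · exact h1

theorem sep_inner_inner {e e' : G.edgeSet} {t t' : Ioo (0 : ℝ) 1}
    (h : (Pt.inner e t : MTOP G) ≠ Pt.inner e' t') :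
    SeparatedNhds ({Pt.inner e t} : Set (MTOP G)) {Pt.inner e' t'} := by
  by_cases he : e = e'
  · subst he
    have ht : t ≠ t' := fun h' => h (h' ▸ rfl)
    obtain ⟨I, J, hI, hJ, h1, h2, h3⟩ := t2_separation ht
    refine ⟨_, _, isOpen_image_inner e hI, isOpen_image_inner e hJ, ?_, ?_, ?_⟩
    · simpa using h1
    · simpa using h2
    · exact (Set.disjoint_image_iff (fun a b h => by simpa using h)).2 h3
  · refine ⟨_, _, isOpen_image_inner e isOpen_univ, isOpen_image_inner e' isOpen_univ, ?_, ?_, ?_⟩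
    · simp
    · simp
    · rw [Set.disjoint_left]
      rintro _ ⟨s, -, rfl⟩ ⟨s', -, h'⟩
      injection h' with h1
      exact he h1.symm

theorem sep_inner_end (e : G.edgeSet) (t : Ioo (0 : ℝ) 1) (R : Ray G) :
    SeparatedNhds ({Pt.inner e t} : Set (MTOP G)) {Pt.endPt (VertexEnd.mk R)} := by
  have hfin : {v | v ∈ (e : Sym2 V)}.Finite := by
    obtain ⟨e, he⟩ := e
    induction e using Sym2.ind with
    | _ x y =>
      refine (Set.toFinite {x, y}).subset fun v hv => ?_
      simpa using hv
  obtain ⟨C, hC⟩ := R.exists_tailInV hfin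
  refine ⟨_, _, isOpen_image_inner e isOpen_univ,
    isOpen_mtopBasic hfin hC (ε := 1 / 2) (by norm_num) (by norm_num), by simp, ?_, ?_⟩
  · rw [Set.singleton_subset_iff]
    exact ⟨R, rfl, hC⟩
  · rw [Set.disjoint_left]
    rintro _ ⟨s, -, rfl⟩ h2
    have key : ∀ y, y ∈ (e : Sym2 V) → y ∉ C := fun y hy hyC => C.notMem_of_mem hyC hy
    rcases h2 with h2 | ⟨x, y, hxy, hx, hy, hd⟩
    · have := Sym2.out_fst_mem (e : Sym2 V)
      exact key _ this (h2 _ this)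
    · exact key y (hxy ▸ Sym2.mem_mk_right x y) hy

theorem sep_end_end {R R' : Ray G} (h : VertexEnd.mk R ≠ VertexEnd.mk R') :
    SeparatedNhds ({Pt.endPt (VertexEnd.mk R)} : Set (MTOP G)) {Pt.endPt (VertexEnd.mk R')} := by
  have h' : ¬ ∀ S : Set V, S.Finite → ∃ C : G.ComponentCompl S, R.TailInV C ∧ R'.TailInV C :=
    fun hr => h (Quotient.sound hr)
  simp only [not_forall] at h'
  obtain ⟨S, hS, hno⟩ := h'
  obtain ⟨C, hC⟩ := R.exists_tailInV hS
  obtain ⟨D, hD⟩ := R'.exists_tailInV hS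
  have hCD : C ≠ D := fun hCD => hno ⟨C, hC, hCD ▸ hD⟩
  refine ⟨_, _, isOpen_mtopBasic hS hC (ε := 1 / 2) (by norm_num) (by norm_num),
    isOpen_mtopBasic hS hD (ε := 1 / 2) (by norm_num) (by norm_num), ?_, ?_, ?_⟩
  · rw [Set.singleton_subset_iff]
    exact ⟨R, rfl, hC⟩
  · rw [Set.singleton_subset_iff]
    exact ⟨R', rfl, hD⟩
  · rw [Set.disjoint_left]
    rintro (u | ⟨e, t⟩ | ω) h1 h2
    · exact hCD (componentCompl_eq_of_mem h1 h2)
    · rcases h1 with h1 | ⟨x, y, hxy, hx, hy, -⟩ <;> rcases h2 with h2 | ⟨x', y', hxy', hx', hy', -⟩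
      · have := Sym2.out_fst_mem (e : Sym2 V)
        exact hCD (componentCompl_eq_of_mem (h1 _ this) (h2 _ this))
      · exact C.notMem_of_mem (h1 x' (hxy' ▸ Sym2.mem_mk_left x' y')) hx'
      · exact D.notMem_of_mem (h2 x (hxy ▸ Sym2.mem_mk_left x y)) hx
      · rcases Sym2.eq_iff.1 (hxy.symm.trans hxy') with ⟨-, rfl⟩ | ⟨-, rfl⟩
        · exact hCD (componentCompl_eq_of_mem hy hy')
        · exact C.notMem_of_mem hy hx'
    · obtain ⟨L, hL, hLC⟩ := h1
      obtain ⟨L', hL', hLD⟩ := h2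
      obtain ⟨B, hB, hB'⟩ := (Quotient.exact (hL.trans hL'.symm) : (vertexSetoid G).r L L') S hS
      exact hCD ((L.tailInV_unique hLC hB).trans (L'.tailInV_unique hB' hLD))

/-- Needed so that a continuous injection of the circle is an embedding. Two ends are separated by a
finite vertex set that distinguishes their rays, an end and a vertex by deleting that vertex, an end
and an inner point by deleting the endpoints of the edge. -/
instance instT2MTOP : T2Space (Pt G (VertexEnd G)) := by
  refine ⟨fun p q hpq => ?_⟩
  suffices h : SeparatedNhds {p} {q} by
    obtain ⟨U, W, hU, hW, h1, h2, h3⟩ := h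
    exact ⟨U, W, hU, hW, h1 rfl, h2 rfl, h3⟩
  rcases p with v | ⟨e, t⟩ | ω <;> rcases q with w | ⟨e', t'⟩ | ω'
  · exact sep_vertex_vertex fun h => hpq (h ▸ rfl)
  · exact sep_vertex_inner v e' t'
  · induction ω' using Quotient.ind with | _ R => exact sep_vertex_end v R
  · exact (sep_vertex_inner w e t).symm
  · exact sep_inner_inner hpq
  · induction ω' using Quotient.ind with | _ R => exact sep_inner_end e t R
  · induction ω using Quotient.ind with | _ R => exact (sep_vertex_end w R).symm
  · induction ω using Quotient.ind with | _ R => exact (sep_inner_end e' t' R).symm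
  · induction ω using Quotient.ind with
    | _ R =>
      induction ω' using Quotient.ind with
      | _ R' => exact sep_end_end fun h => hpq (congrArg Pt.endPt h)

theorem arc_cases (Ω : Type u) {a b : V} (h : G.Adj a b) (s : ℝ) :
    s ≤ 0 ∧ (arc h s : Pt G Ω) = Pt.vertex a ∨ 1 ≤ s ∧ (arc h s : Pt G Ω) = Pt.vertex b ∨
      s ∈ Ioo (0 : ℝ) 1 ∧ ∃ t, (arc h s : Pt G Ω) = Pt.inner ⟨s(a, b), h⟩ t ∧
        distIn (G := G) ⟨s(a, b), h⟩ t a = s ∧ distIn (G := G) ⟨s(a, b), h⟩ t b = 1 - s := by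
  rcases le_or_gt s 0 with h0 | h0
  · exact Or.inl ⟨h0, arc_of_le_zero h h0⟩
  rcases le_or_gt 1 s with h1 | h1
  · exact Or.inr (Or.inl ⟨h1, arc_of_one_le h h1⟩)
  · exact Or.inr (Or.inr ⟨⟨h0, h1⟩, arc_of_mem h ⟨h0, h1⟩⟩)

theorem isOpen_arc_preimage_inner {a b : V} (h : G.Adj a b) (e : G.edgeSet)
    {I : Set (Ioo (0 : ℝ) 1)} (hI : IsOpen I) :
    IsOpen ((arc h : ℝ → MTOP G) ⁻¹' (Pt.inner e '' I)) := by
  rw [isOpen_iff_mem_nhds]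
  intro s hs
  rcases arc_cases (VertexEnd G) h s with ⟨-, h2⟩ | ⟨-, h2⟩ | ⟨hs1, t, h2, h3, -⟩
  · simp [h2] at hs
  · simp [h2] at hs
  simp only [mem_preimage, h2, mem_image] at hs
  obtain ⟨t1, ht1, h4⟩ := hs
  injection h4 with h5 h6
  subst h5 h6
  obtain ⟨J, hJ, rfl⟩ := isOpen_induced_iff.1 hI
  by_cases hc : a = (Quot.out s(a, b)).1
  · have : Ioo (0 : ℝ) 1 ∩ J ∈ 𝓝 s := by
      refine inter_mem (isOpen_Ioo.mem_nhds hs1) (hJ.mem_nhds ?_)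
      simp only [distIn] at h3
      rw [if_pos hc] at h3
      rw [← h3]; exact ht1
    filter_upwards [this] with s' hs'
    obtain ⟨t', h2', h3', -⟩ := arc_of_mem (Ω := VertexEnd G) h hs'.1
    refine ⟨t', ?_, h2'.symm⟩
    simp only [distIn] at h3'
    rw [if_pos hc] at h3'
    rw [mem_preimage, h3']; exact hs'.2
  · have : Ioo (0 : ℝ) 1 ∩ (fun r => 1 - r) ⁻¹' J ∈ 𝓝 s := by
      refine inter_mem (isOpen_Ioo.mem_nhds hs1)
        ((hJ.preimage (by fun_prop : Continuous fun r : ℝ => 1 - r)).mem_nhds ?_)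
      simp only [distIn] at h3
      rw [if_neg hc] at h3
      rw [mem_preimage, ← h3, sub_sub_cancel]; exact ht1
    filter_upwards [this] with s' hs'
    obtain ⟨t', h2', h3', -⟩ := arc_of_mem (Ω := VertexEnd G) h hs'.1
    refine ⟨t', ?_, h2'.symm⟩
    simp only [distIn] at h3'
    rw [if_neg hc] at h3'
    have : (t' : ℝ) = 1 - s' := by linarith
    rw [mem_preimage, this]; exact hs'.2

/-- The arc is constant outside `[0, 1]`, so the preimages of stars and of basic sets around ends
are empty, open half-lines or all of `ℝ`. If exactly one of `a`, `b` lies in `C`, then the other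
lies in `S`, because a component absorbs its neighbours outside `S`. -/
theorem continuous_arc {a b : V} (h : G.Adj a b) : Continuous (arc h : ℝ → MTOP G) := by
  rw [continuous_generateFrom_iff]
  rintro U ((⟨e, I, hI, rfl⟩ | ⟨v, ε, h0, h1, rfl⟩) | ⟨S, R, C, ε, hS, hR, h0, h1, rfl⟩)
  · exact isOpen_arc_preimage_inner h e hI
  · by_cases hva : v = a
    · subst hva
      convert isOpen_Iio (a := ε) using 1
      ext s
      rw [mem_preimage, mem_Iio]
      rcases arc_cases (VertexEnd G) h s with ⟨h1, h2⟩ | ⟨h1, h2⟩ | ⟨hs1, t, h2, h3, -⟩ <;> rw [h2]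
      · simp only [openStar, mem_ofPred_eq, true_iff]; linarith
      · simp only [openStar, mem_ofPred_eq, h.ne.symm, false_iff]; linarith
      · simp [openStar, h3]
    by_cases hvb : v = b
    · subst hvb
      convert isOpen_Ioi (a := 1 - ε) using 1
      ext s
      rw [mem_preimage, mem_Ioi]
      rcases arc_cases (VertexEnd G) h s with ⟨h1, h2⟩ | ⟨h1, h2⟩ | ⟨hs1, t, h2, -, h3⟩ <;> rw [h2]
      · simp only [openStar, mem_ofPred_eq, h.ne, false_iff]; linarith
      · simp only [openStar, mem_ofPred_eq, true_iff]; linarith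
      · simp only [openStar, mem_ofPred_eq, h3, Sym2.mem_iff, or_true, true_and]
        constructor <;> intro <;> linarith
    · convert isOpen_empty using 1
      ext s
      rw [mem_preimage]
      rcases arc_cases (VertexEnd G) h s with ⟨h1, h2⟩ | ⟨h1, h2⟩ | ⟨hs1, t, h2, -, h3⟩ <;> rw [h2] <;>
        simp [openStar, hva, hvb, Ne.symm hva, Ne.symm hvb]
  · by_cases ha : a ∈ C <;> by_cases hb : b ∈ C
    · convert isOpen_univ using 1
      ext s
      rw [mem_preimage]
      rcases arc_cases (VertexEnd G) h s with ⟨h1, h2⟩ | ⟨h1, h2⟩ | ⟨hs1, t, h2, -, h3⟩ <;> rw [h2]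
      · exact iff_of_true ha trivial
      · exact iff_of_true hb trivial
      · refine iff_of_true (Or.inl fun y hy => ?_) trivial
        rcases Sym2.mem_iff.1 hy with rfl | rfl
        exacts [ha, hb]
    · have hbS : b ∈ S := by
        by_contra hbS
        exact hb (SimpleGraph.ComponentCompl.mem_of_adj _ _ ha hbS h)
      convert isOpen_Iio (a := ε) using 1
      ext s
      rw [mem_preimage, mem_Iio]
      rcases arc_cases (VertexEnd G) h s with ⟨h1, h2⟩ | ⟨h1, h2⟩ | ⟨hs1, t, h2, h3, -⟩ <;> rw [h2]
      · simp only [mtopBasic, mem_ofPred_eq, ha, true_iff]; linarith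
      · simp only [mtopBasic, mem_ofPred_eq, hb, false_iff]; linarith
      · rw [← h3]
        constructor
        · rintro (h4 | ⟨x, y, h4, h5, h6, h7⟩)
          · exact absurd (h4 b (Sym2.mem_mk_right a b)) hb
          · rcases Sym2.eq_iff.1 h4 with ⟨rfl, rfl⟩ | ⟨rfl, rfl⟩
            · exact absurd h6 hb
            · exact h7
        · exact fun h4 => Or.inr ⟨b, a, Sym2.eq_swap, hbS, ha, h4⟩
    · have haS : a ∈ S := by
        by_contra haS
        exact ha (SimpleGraph.ComponentCompl.mem_of_adj _ _ hb haS h.symm)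
      convert isOpen_Ioi (a := 1 - ε) using 1
      ext s
      rw [mem_preimage, mem_Ioi]
      rcases arc_cases (VertexEnd G) h s with ⟨h1, h2⟩ | ⟨h1, h2⟩ | ⟨hs1, t, h2, -, h3⟩ <;> rw [h2]
      · simp only [mtopBasic, mem_ofPred_eq, ha, false_iff]; linarith
      · simp only [mtopBasic, mem_ofPred_eq, hb, true_iff]; linarith
      · constructor
        · rintro (h4 | ⟨x, y, h4, h5, h6, h7⟩)
          · exact absurd (h4 a (Sym2.mem_mk_left a b)) ha
          · rcases Sym2.eq_iff.1 h4 with ⟨rfl, rfl⟩ | ⟨rfl, rfl⟩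
            · linarith
            · exact absurd h6 ha
        · exact fun h4 => Or.inr ⟨a, b, rfl, haS, hb, by linarith⟩
    · convert isOpen_empty using 1
      ext s
      rw [mem_preimage]
      rcases arc_cases (VertexEnd G) h s with ⟨h1, h2⟩ | ⟨h1, h2⟩ | ⟨hs1, t, h2, -, h3⟩ <;> rw [h2]
      · simpa [mtopBasic] using ha
      · simpa [mtopBasic] using hb
      · simp only [mem_empty_iff_false, iff_false]
        rintro (h4 | ⟨x, y, h4, h5, h6, h7⟩)
        · exact ha (h4 a (Sym2.mem_mk_left a b))
        · rcases Sym2.eq_iff.1 h4 with ⟨rfl, rfl⟩ | ⟨rfl, rfl⟩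
          · exact hb h6
          · exact ha h6

end MTOP

/-! ### Finite cuts and topological Euler tours -/

/-- The edges of `C` between `A` and its complement. -/
def cut (C : SimpleGraph V) (A : Set V) : Set (Sym2 V) :=
  {e | ∃ u w, u ∈ A ∧ w ∉ A ∧ C.Adj u w ∧ e = s(u, w)}

/-- Every finite cut of `C` is even or odd according to whether it does not or does separate
`a` from `b`: the parity condition for an Euler trail from `a` to `b`. -/
def EvenCuts (C : SimpleGraph V) (a b : V) : Prop :=
  ∀ A : Set V, (cut C A).Finite → (Even (cut C A).ncard ↔ (a ∈ A ↔ b ∈ A))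

theorem cut_subset (C : SimpleGraph V) (A : Set V) : cut C A ⊆ C.edgeSet := by
  rintro _ ⟨u, w, -, -, h, rfl⟩
  exact h

theorem cut_compl (C : SimpleGraph V) (A : Set V) : cut C Aᶜ = cut C A := by
  ext e
  constructor
  · rintro ⟨u, w, hu, hw, h, rfl⟩
    exact ⟨w, u, not_not.1 hw, hu, h.symm, Sym2.eq_swap⟩
  · rintro ⟨u, w, hu, hw, h, rfl⟩
    exact ⟨w, u, hw, not_not.2 hu, h.symm, Sym2.eq_swap⟩

theorem mem_cut_iff {C : SimpleGraph V} {A : Set V} {u w : V} (h : C.Adj u w) :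
    s(u, w) ∈ cut C A ↔ ¬ (u ∈ A ↔ w ∈ A) := by
  constructor
  · rintro ⟨u', w', hu, hw, -, he⟩
    rcases Sym2.eq_iff.1 he with ⟨rfl, rfl⟩ | ⟨rfl, rfl⟩ <;> tauto
  · intro hn
    by_cases hu : u ∈ A
    · exact ⟨u, w, hu, by tauto, h, rfl⟩
    · exact ⟨w, u, by tauto, hu, h.symm, Sym2.eq_swap⟩

theorem mem_iff_of_reachable {C : SimpleGraph V} {A : Set V} (hA : cut C A = ∅) {u w : V}
    (h : C.Reachable u w) : u ∈ A ↔ w ∈ A := by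
  obtain ⟨p⟩ := h
  induction p with
  | nil => rfl
  | cons h p ih =>
    have := (mem_cut_iff (A := A) h).not
    rw [hA] at this
    simp only [mem_empty_iff_false, not_false_eq_true, true_iff, not_not] at this
    exact this.trans ih

theorem cut_reachable (C : SimpleGraph V) (u : V) : cut C {v | C.Reachable u v} = ∅ := by
  rw [Set.eq_empty_iff_forall_notMem]
  rintro _ ⟨v, w, hv, hw, h, -⟩
  exact hw (SimpleGraph.Reachable.trans hv h.reachable)

theorem cut_deleteEdges_cut (G : SimpleGraph V) (A : Set V) :
    cut (G.deleteEdges (cut G A)) A = ∅ := by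
  rw [Set.eq_empty_iff_forall_notMem]
  rintro _ ⟨v, w, hv, hw, h, -⟩
  rw [SimpleGraph.deleteEdges_adj] at h
  exact h.2 ⟨v, w, hv, hw, h.1, rfl⟩

/-- The component of `a` has an empty, hence even, cut, so it cannot separate `a` from `b`. -/
theorem EvenCuts.reachable {C : SimpleGraph V} {a b : V} (h : EvenCuts C a b) :
    C.Reachable a b := by
  have h1 := h {v | C.Reachable a v} (by rw [cut_reachable]; exact finite_empty)
  rw [cut_reachable, ncard_empty] at h1
  exact (h1.1 Even.zero).1 (SimpleGraph.Reachable.refl a)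

/-! ### The potential of a finite cut -/

section Potential

variable (G : SimpleGraph V) (A : Set V)

open Classical in
/-- The function on `ETOP'(G)` that is `1 / 2` on the side `A` of a cut, `-1 / 2` on the other
side, and linear on the edges of the cut. -/
noncomputable def cutPotential : ETOP' G → ℝ
  | Pt.vertex v => if v ∈ A then 1 / 2 else -1 / 2
  | Pt.inner e t =>
    if h : (e : Sym2 V) ∈ cut G A then 1 / 2 - distIn e t h.choose
    else if ∃ y ∈ (e : Sym2 V), y ∈ A then 1 / 2 else -1 / 2
  | Pt.endPt ω => if ∃ R : Ray G, EdgeEnd.mk R = ω ∧ ∀ᶠ n in atTop, R.vert n ∈ A then 1 / 2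
    else -1 / 2

variable {G A}

/-- A cut edge has only one endpoint in `A`, so the choice made in the definition does not matter.
-/
theorem cutPotential_of_mem_cut {e : G.edgeSet} (h : (e : Sym2 V) ∈ cut G A) (t : Ioo (0 : ℝ) 1)
    {y : V} (hy : y ∈ (e : Sym2 V)) (hyA : y ∈ A) :
    cutPotential G A (Pt.inner e t) = 1 / 2 - distIn e t y := by
  have h1 := h.choose_spec
  obtain ⟨w, hu, hw, -, he⟩ := h1
  have : y = h.choose := by
    rw [he] at hy
    rcases Sym2.mem_iff.1 hy with h2 | h2
    · exact h2
    · exact absurd (h2 ▸ hyA) hw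
  simp only [cutPotential]
  rw [dif_pos h, ← this]

/-- Each component left after deleting the finite cut lies on one side of it, and edge-equivalent
rays have tails in the same component. So all rays of an edge-end finally stay on the same side. -/
theorem cutPotential_ends {R : Ray G} (hF : (cut G A).Finite) :
    (∀ᶠ n in atTop, R.vert n ∈ A) ∧ cutPotential G A (Pt.endPt (EdgeEnd.mk R)) = 1 / 2 ∨
    (∀ᶠ n in atTop, R.vert n ∈ Aᶜ) ∧ cutPotential G A (Pt.endPt (EdgeEnd.mk R)) = -1 / 2 := by
  have key : ∀ L : Ray G, EdgeEnd.mk L = EdgeEnd.mk R →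
      ∃ C : (G.deleteEdges (cut G A)).ConnectedComponent, L.TailInE C ∧ R.TailInE C :=
    fun L hL => (Quotient.exact hL : (edgeSetoid G).r L R) _ (cut_subset G A) hF
  have side : ∀ (C : (G.deleteEdges (cut G A)).ConnectedComponent) (v w : V), v ∈ C.supp →
      w ∈ C.supp → (v ∈ A ↔ w ∈ A) := by
    intro C v w hv hw
    exact mem_iff_of_reachable (cut_deleteEdges_cut G A)
      (SimpleGraph.ConnectedComponent.exact (Eq.trans hv (Eq.symm hw)))
  obtain ⟨C, hC, -⟩ := key R rfl
  obtain ⟨v, hv⟩ := hC.exists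
  by_cases hA : R.vert v ∈ A
  · left
    have h1 : ∀ᶠ n in atTop, R.vert n ∈ A := hC.mono fun n hn => (side C _ _ hv hn).1 hA
    exact ⟨h1, if_pos ⟨R, rfl, h1⟩⟩
  · right
    have h1 : ∀ᶠ n in atTop, R.vert n ∈ Aᶜ := hC.mono fun n hn h => hA ((side C _ _ hv hn).2 h)
    refine ⟨h1, if_neg ?_⟩
    rintro ⟨L, hL, hLA⟩
    obtain ⟨D, hLD, hRD⟩ := key L hL
    obtain ⟨n, hn, hn'⟩ := (hLD.and hLA).exists
    obtain ⟨m, hm, hm'⟩ := (hRD.and h1).exists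
    exact hm' ((side D _ _ hn hm).1 hn')

theorem neg_half_le_cutPotential (p : ETOP' G) : -1 / 2 ≤ cutPotential G A p := by
  rcases p with v | ⟨e, t⟩ | ω <;> simp only [cutPotential]
  · split_ifs <;> norm_num
  · split_ifs
    · linarith [distIn_lt_one e t (Exists.choose ‹(e : Sym2 V) ∈ cut G A›)]
    · norm_num
    · norm_num
  · split_ifs <;> norm_num

/-- Exchanging the sides turns upper bounds into lower bounds, so only one of the two
semicontinuities needs a direct proof. -/
theorem cutPotential_compl (hF : (cut G A).Finite) (p : ETOP' G) :
    cutPotential G Aᶜ p = - cutPotential G A p := by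
  rcases p with v | ⟨e, t⟩ | ω
  · by_cases hv : v ∈ A <;> simp [cutPotential, hv] <;> norm_num
  · by_cases he : (e : Sym2 V) ∈ cut G A
    · obtain ⟨u, w, hu, hw, hadj, hee⟩ := id he
      rw [cutPotential_of_mem_cut he t (y := u) (by rw [hee]; simp) hu,
        cutPotential_of_mem_cut (A := Aᶜ) (by rwa [cut_compl]) t (y := w) (by rw [hee]; simp) hw]
      linarith [distIn_add_distIn e t hee hadj.ne]
    · have he' : (e : Sym2 V) ∉ cut G Aᶜ := by rwa [cut_compl]
      simp only [cutPotential]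
      rw [dif_neg he, dif_neg he']
      obtain ⟨e, hadj⟩ := e
      induction e using Sym2.ind with
      | _ x y =>
        have := (mem_cut_iff (A := A) (G.mem_edgeSet.1 hadj)).not.1 he
        by_cases hx : x ∈ A <;> simp_all <;> norm_num
  · induction ω using Quotient.ind with
    | _ R =>
      have h1 := cutPotential_ends (R := R) hF
      have h2 := cutPotential_ends (A := Aᶜ) (R := R) (by rwa [cut_compl])
      change cutPotential G Aᶜ (Pt.endPt (EdgeEnd.mk R)) = - cutPotential G A (Pt.endPt (EdgeEnd.mk R))
      rw [compl_compl] at h2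
      rcases h1 with ⟨h3, h4⟩ | ⟨h3, h4⟩ <;> rcases h2 with ⟨h5, h6⟩ | ⟨h5, h6⟩
      · obtain ⟨n, h7, h8⟩ := (h3.and h5).exists
        exact absurd h7 h8
      · rw [h4, h6]; norm_num
      · rw [h4, h6]; norm_num
      · obtain ⟨n, h7, h8⟩ := (h3.and h5).exists
        exact absurd h8 h7

theorem isOpen_lt_cutPotential (hF : (cut G A).Finite) (c : ℝ) :
    IsOpen {p | c < cutPotential G A p} := by
  rcases lt_or_ge c (-1 / 2) with hc | hc
  · convert isOpen_univ
    exact eq_univ_of_forall fun p => hc.trans_le (neg_half_le_cutPotential p)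
  -- On a cut edge, the point at distance `d` from the endpoint in `A` has potential `1/2 - d`, so
  -- the radius `1/2 - c` keeps the value above `c`. The cap `1/2` keeps the radius below `1` when
  -- `c = -1/2`.
  have basic : ∀ C : (G.deleteEdges (cut G A)).ConnectedComponent, (∃ v ∈ C.supp, v ∈ A) →
      c < 1 / 2 → ∃ U ⊆ {p | c < cutPotential G A p}, IsOpen U ∧
        U = etopBasic G (cut G A) C (fun _ _ => min (1 / 2) (1 / 2 - c)) := by
    rintro C ⟨v, hv, hvA⟩ hc'
    have side : ∀ w ∈ C.supp, w ∈ A := fun w hw =>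
      (mem_iff_of_reachable (cut_deleteEdges_cut G A)
        (SimpleGraph.ConnectedComponent.exact (Eq.trans hv (Eq.symm hw)))).1 hvA
    refine ⟨_, ?_, TopologicalSpace.isOpen_generateFrom_of_mem
      (Or.inr ⟨cut G A, C, _, cut_subset G A, hF, fun e y => ⟨?_, ?_⟩, rfl⟩), rfl⟩
    · rintro (w | ⟨e, t⟩ | ω) hp
      · have := side w hp
        simpa [cutPotential, this] using hc'
      · rcases hp with ⟨he, y, hy, hyC⟩ | ⟨he, y, hy, hyC, hd⟩
        · have h1 : ∃ y ∈ (e : Sym2 V), y ∈ A := ⟨y, hy, side y hyC⟩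
          simp only [mem_ofPred_eq, cutPotential]
          rwa [dif_neg he, if_pos h1]
        · rw [mem_ofPred_eq, cutPotential_of_mem_cut he t hy (side y hyC)]
          have := hd.trans_le (min_le_right _ _)
          linarith
      · obtain ⟨R, rfl, hR⟩ := hp
        rw [mem_ofPred_eq]
        simp only [cutPotential]
        rwa [if_pos ⟨R, rfl, hR.mono fun n hn => side _ hn⟩]
    · exact lt_min (by norm_num) (by linarith)
    · exact (min_le_left _ _).trans_lt (by norm_num)
  rw [isOpen_iff_forall_mem_open]
  rintro (v | ⟨e, t⟩ | ω) hp
  · have hv : v ∈ A := by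
      by_contra h
      simp only [mem_ofPred_eq, cutPotential, if_neg h] at hp
      linarith
    have hc' : c < 1 / 2 := by simpa [cutPotential, hv] using hp
    obtain ⟨U, hU, hUo, rfl⟩ := basic ((G.deleteEdges (cut G A)).connectedComponentMk v)
      ⟨v, rfl, hv⟩ hc'
    exact ⟨_, hU, hUo, rfl⟩
  · by_cases he : (e : Sym2 V) ∈ cut G A
    · obtain ⟨u, w, hu, hw, hadj, hee⟩ := id he
      have hue : u ∈ (e : Sym2 V) := by rw [hee]; simp
      refine ⟨Pt.inner e '' {t | c < 1 / 2 - distIn e t u}, ?_,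
        TopologicalSpace.isOpen_generateFrom_of_mem (Or.inl ⟨e, _, isOpen_lt continuous_const
          (continuous_const.sub (continuous_distIn e u)), rfl⟩), ⟨t, ?_, rfl⟩⟩
      · rintro _ ⟨t', ht', rfl⟩
        rwa [mem_ofPred_eq, cutPotential_of_mem_cut he t' hue hu]
      · rwa [mem_ofPred_eq, cutPotential_of_mem_cut he t hue hu] at hp
    · have hy : ∃ y ∈ (e : Sym2 V), y ∈ A := by
        by_contra h
        simp only [mem_ofPred_eq, cutPotential] at hp
        rw [dif_neg he, if_neg h] at hp
        linarith
      have hc' : c < 1 / 2 := by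
        simp only [mem_ofPred_eq, cutPotential] at hp
        rwa [dif_neg he, if_pos hy] at hp
      obtain ⟨y, hye, hyA⟩ := hy
      obtain ⟨U, hU, hUo, rfl⟩ := basic ((G.deleteEdges (cut G A)).connectedComponentMk y)
        ⟨y, rfl, hyA⟩ hc'
      exact ⟨_, hU, hUo, Or.inl ⟨he, y, hye, rfl⟩⟩
  · induction ω using Quotient.ind with
    | _ R =>
      obtain ⟨h1, h2⟩ : (∀ᶠ n in atTop, R.vert n ∈ A) ∧
          cutPotential G A (Pt.endPt (EdgeEnd.mk R)) = 1 / 2 := by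
        refine (cutPotential_ends hF).resolve_right fun h => ?_
        have : c < _ := hp
        linarith [h.2.symm.trans_gt this]
      have hc' : c < 1 / 2 := h2 ▸ hp
      obtain ⟨C, hC⟩ := R.exists_tailInE hF
      obtain ⟨n, hn, hn'⟩ := (hC.and h1).exists
      obtain ⟨U, hU, hUo, rfl⟩ := basic C ⟨_, hn, hn'⟩ hc'
      exact ⟨_, hU, hUo, R, rfl, hC⟩

theorem continuous_cutPotential (hF : (cut G A).Finite) : Continuous (cutPotential G A) := by
  rw [continuous_iff_continuousAt]
  intro p
  rw [ContinuousAt, tendsto_order]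
  refine ⟨fun c hc => (isOpen_lt_cutPotential hF c).mem_nhds hc, fun c hc => ?_⟩
  have h := isOpen_lt_cutPotential (A := Aᶜ) (by rwa [cut_compl]) (-c)
  simp only [cutPotential_compl hF, neg_lt_neg_iff] at h
  exact h.mem_nhds hc

end Potential

/-- A function whose zeros are isolated sign changes changes its sign between `a` and `b` if and
only if it has an odd number of zeros there. -/
theorem even_ncard_zeros_iff {f : ℝ → ℝ} (hf : Continuous f) {b : ℝ} (hb : f b ≠ 0) (n : ℕ) :
    ∀ a ≤ b, f a ≠ 0 → {t ∈ Icc a b | f t = 0}.Finite → {t ∈ Icc a b | f t = 0}.ncard = n →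
      (∀ z ∈ Icc a b, f z = 0 → ∃ δ > 0, InjOn f (Ioo (z - δ) (z + δ))) →
      (Even n ↔ 0 < f a * f b) := by
  have same : ∀ c d, c ≤ d → (∀ t ∈ Icc c d, f t ≠ 0) → 0 < f c * f d := by
    intro c d hcd h
    by_contra hneg
    have h0 : (0 : ℝ) ∈ uIcc (f c) (f d) := by
      rw [mem_uIcc]
      rcases le_total (f c) 0 with h1 | h1 <;> rcases le_total (f d) 0 with h2 | h2
      · exact absurd (mul_pos_of_neg_of_neg (h1.lt_of_ne (h c ⟨le_rfl, hcd⟩))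
          (h2.lt_of_ne (h d ⟨hcd, le_rfl⟩))) hneg
      · exact Or.inl ⟨h1, h2⟩
      · exact Or.inr ⟨h2, h1⟩
      · exact absurd (mul_pos (h1.lt_of_ne' (h c ⟨le_rfl, hcd⟩))
          (h2.lt_of_ne' (h d ⟨hcd, le_rfl⟩))) hneg
    obtain ⟨t, ht, ht0⟩ := intermediate_value_uIcc hf.continuousOn h0
    rw [uIcc_of_le hcd] at ht
    exact h t ht ht0
  induction n with
  | zero =>
    intro a hab ha hfin hcard _
    rw [ncard_eq_zero hfin, Set.eq_empty_iff_forall_notMem] at hcard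
    simp only [Even.zero, true_iff]
    exact same a b hab fun t ht h0 => hcard t ⟨ht, h0⟩
  | succ n ih =>
    intro a hab ha hfin hcard hinj
    have hne : {t ∈ Icc a b | f t = 0}.Nonempty := by
      rw [← ncard_pos hfin, hcard]
      exact Nat.succ_pos n
    -- The leftmost zero `z` is split off. On a small interval `[c, d]` around it `f` is injective,
    -- hence strictly monotone, and so changes sign between `c` and `d`; the remaining zeros lie in
    -- `[d, b]`.
    obtain ⟨z, ⟨hz, hz0⟩, hmin⟩ := Set.exists_min_image _ id hfin hne
    obtain ⟨δ, hδ, hδi⟩ := hinj z hz hz0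
    have haz : a < z := hz.1.lt_of_ne fun h => ha (h ▸ hz0)
    have hzb : z < b := hz.2.lt_of_ne fun h => hb (h ▸ hz0)
    set c := max a (z - δ / 2) with hc
    set d := min b (z + δ / 2) with hd
    have hac : a ≤ c := le_max_left _ _
    have hcz : c < z := max_lt haz (by linarith)
    have hzd : z < d := lt_min hzb (by linarith)
    have hdb : d ≤ b := min_le_left _ _
    have hc' : z - δ / 2 ≤ c := le_max_right _ _
    have hd' : d ≤ z + δ / 2 := min_le_right _ _
    have hinj' : InjOn f (Icc c d) := hδi.mono
      (Icc_subset_Ioo (by linarith) (by linarith))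
    have hac' : 0 < f a * f c := same a c hac fun t ht h0 => by
      have : z ≤ t := hmin t ⟨⟨ht.1, ht.2.trans (hcz.le.trans hzb.le)⟩, h0⟩
      linarith [ht.2]
    have hzm : z ∈ Icc c d := ⟨hcz.le, hzd.le⟩
    have hnz : ∀ t ∈ Icc c d, f t = 0 → t = z := fun t ht h0 => hinj' ht hzm (h0.trans hz0.symm)
    have hcd : f c * f d < 0 := by
      have hcm : c ∈ Icc c d := ⟨le_rfl, by linarith⟩
      have hdm : d ∈ Icc c d := ⟨by linarith, le_rfl⟩
      rcases hf.continuousOn.strictMonoOn_of_injOn_Icc' (by linarith : c ≤ d) hinj' with h | h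
      · have h1 := h hcm hzm hcz
        have h2 := h hzm hdm hzd
        rw [hz0] at h1 h2
        exact mul_neg_of_neg_of_pos h1 h2
      · have h1 := h hcm hzm hcz
        have h2 := h hzm hdm hzd
        rw [hz0] at h1 h2
        exact mul_neg_of_pos_of_neg h1 h2
    have hset : {t ∈ Icc d b | f t = 0} = {t ∈ Icc a b | f t = 0} \ {z} := by
      ext t
      rw [Set.mem_sdiff, mem_singleton_iff]
      constructor
      · rintro ⟨h1, h2⟩
        exact ⟨⟨⟨by linarith [h1.1], h1.2⟩, h2⟩, fun h3 => by have := h1.1; rw [h3] at this; linarith⟩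
      · rintro ⟨⟨h1, h2⟩, h3⟩
        have h4 : z ≤ t := hmin t ⟨h1, h2⟩
        refine ⟨⟨?_, h1.2⟩, h2⟩
        by_contra h5
        exact h3 (hnz t ⟨by linarith, by linarith⟩ h2)
    have := ih d hdb (right_ne_zero_of_mul hcd.ne) (by rw [hset]; exact hfin.sdiff)
      (by rw [hset, ncard_sdiff_singleton_of_mem (show z ∈ {t ∈ Icc a b | f t = 0} from ⟨hz, hz0⟩), hcard]; rfl)
      fun y hy => hinj y ⟨by linarith [hy.1], hy.2⟩
    rw [Nat.even_add_one, this]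
    have had : f a * f d < 0 := by
      by_contra h
      nlinarith [sq_nonneg (f c), mul_nonneg (not_lt.1 h) hac'.le, mul_pos_of_neg_of_neg hcd hcd,
        mul_neg_of_pos_of_neg hac' hcd, mul_self_nonneg (f c),
        mul_nonneg (mul_self_nonneg (f c)) (not_lt.1 h)]
    constructor
    · intro h
      have h1 : f d * f b < 0 := (not_lt.1 h).lt_of_ne
        (mul_ne_zero (right_ne_zero_of_mul hcd.ne) hb)
      by_contra h2
      nlinarith [mul_pos_of_neg_of_neg had h1, mul_self_nonneg (f d),
        mul_nonneg (mul_self_nonneg (f d)) (neg_nonneg.2 (not_lt.1 h2))]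
    · intro h h1
      nlinarith [mul_neg_of_neg_of_pos had h1, mul_nonneg (mul_self_nonneg (f d)) h.le]

/-! ### Consequences of a topological Euler tour: parity and connectedness -/

section EulerTour

variable {G : SimpleGraph V} {σ : Circle → ETOP G}

/-- The value of the potential of a cut along a tour. -/
noncomputable def tourPotential {A : Set V} (hF : (cut G A).Finite) (σ : Circle → ETOP G)
    (x : Circle) : ℝ :=
  SeparationQuotient.lift (cutPotential G A)
    (fun _ _ h => (h.map (continuous_cutPotential hF)).eq) (σ x)

theorem tourPotential_eq {A : Set V} (hF : (cut G A).Finite) {x : Circle} {p : ETOP' G}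
    (h : σ x = SeparationQuotient.mk p) : tourPotential hF σ x = cutPotential G A p := by
  rw [tourPotential, h, SeparationQuotient.lift_mk]

theorem continuous_tourPotential {A : Set V} (hF : (cut G A).Finite) (hσ : Continuous σ) :
    Continuous (tourPotential hF σ) :=
  (SeparationQuotient.continuous_lift (continuous_cutPotential hF)).comp hσ

theorem cutPotential_eq_zero {A : Set V} {p : ETOP' G} (h : cutPotential G A p = 0) :
    ∃ e t, p = Pt.inner e t ∧ (e : Sym2 V) ∈ cut G A ∧ (t : ℝ) = 1 / 2 := by
  rcases p with v | ⟨e, t⟩ | ω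
  · exfalso
    simp only [cutPotential] at h
    split_ifs at h <;> norm_num at h
  · refine ⟨e, t, rfl, ?_⟩
    simp only [cutPotential] at h
    split_ifs at h with h1 h2 <;> norm_num at h
    refine ⟨h1, ?_⟩
    unfold distIn at h
    split_ifs at h <;> linarith
  · exfalso
    simp only [cutPotential] at h
    split_ifs at h <;> norm_num at h

theorem cutPotential_half {A : Set V} {e : G.edgeSet} {t : Ioo (0 : ℝ) 1}
    (h : (e : Sym2 V) ∈ cut G A) (ht : (t : ℝ) = 1 / 2) : cutPotential G A (Pt.inner e t) = 0 := by
  simp only [cutPotential]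
  rw [dif_pos h]
  unfold distIn
  split_ifs <;> linarith

/-- Along the tour the potential vanishes exactly at the midpoints of the cut edges, each visited
once, and it changes sign there because the tour is injective along the edge. A closed curve has an
even number of sign changes. -/
theorem IsTopologicalEulerTour.evenCuts (hσ : IsTopologicalEulerTour G σ) (u : V) :
    EvenCuts G u u := by
  intro A hF
  simp only [iff_self, iff_true]
  rcases (cut G A).eq_empty_or_nonempty with hem | ⟨e₀, he₀⟩
  · rw [hem]; simp
  have hc := continuous_tourPotential hF hσ.1
  let half : Ioo (0 : ℝ) 1 := ⟨1 / 2, by norm_num, by norm_num⟩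
  choose x hx hx' using fun e : G.edgeSet => hσ.2 e half
  have hzero : {y | tourPotential hF σ y = 0} = x '' {e | (e : Sym2 V) ∈ cut G A} := by
    ext y
    constructor
    · intro hy
      obtain ⟨p, hp⟩ := SeparationQuotient.surjective_mk (σ y)
      have hy : tourPotential hF σ y = 0 := hy
      rw [tourPotential_eq hF hp.symm] at hy
      obtain ⟨e, t, rfl, he, ht⟩ := cutPotential_eq_zero hy
      refine ⟨e, he, (hx' e y ?_).symm⟩
      have : t = half := Subtype.ext ht
      change σ y = _
      rw [← hp, this]
    · rintro ⟨e, he, rfl⟩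
      exact (tourPotential_eq hF (hx e)).trans (cutPotential_half he rfl)
  -- The interior of an edge is open in `ETOP'(G)`, so midpoints of different edges are not
  -- identified in `ETOP(G)`.
  have hinj : InjOn x {e | (e : Sym2 V) ∈ cut G A} := by
    intro e he e' he' hee
    have h0 : SeparationQuotient.mk (Pt.inner e half : ETOP' G) =
        SeparationQuotient.mk (Pt.inner e' half) := (hx e).symm.trans ((congrArg σ hee).trans (hx e'))
    have h1 := SeparationQuotient.mk_eq_mk.1 h0
    have hopen : IsOpen (Pt.inner e '' univ : Set (ETOP' G)) :=
      TopologicalSpace.isOpen_generateFrom_of_mem (Or.inl ⟨e, _, isOpen_univ, rfl⟩)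
    obtain ⟨t, -, ht⟩ := (h1.mem_open_iff hopen).1 ⟨half, trivial, rfl⟩
    injection ht
  have hcard : {y | tourPotential hF σ y = 0}.ncard = (cut G A).ncard := by
    rw [hzero, hinj.ncard_image, ← ncard_image_of_injective _ Subtype.val_injective]
    congr 1
    ext e
    exact ⟨fun ⟨e', h, h'⟩ => h' ▸ h, fun h => ⟨⟨e, cut_subset G A h⟩, h, rfl⟩⟩
  have hfin : {y | tourPotential hF σ y = 0}.Finite := by
    rw [hzero]
    exact (hF.preimage Subtype.val_injective.injOn).image x
  -- a base point that is not a zero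
  obtain ⟨a, ha⟩ : ∃ a : ℝ, tourPotential hF σ (Circle.exp a) ≠ 0 := by
    let e : G.edgeSet := ⟨e₀, cut_subset G A he₀⟩
    obtain ⟨y, hy, -⟩ := hσ.2 e ⟨1 / 4, by norm_num, by norm_num⟩
    obtain ⟨a, -, rfl⟩ := Circle.surjOn_exp_neg_pi_pi (mem_univ y)
    refine ⟨a, fun h => ?_⟩
    rw [tourPotential_eq hF hy] at h
    obtain ⟨e', t, h1, -, h2⟩ := cutPotential_eq_zero h
    injection h1 with h3 h4
    rw [← h4] at h2
    norm_num at h2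
  have hper : tourPotential hF σ (Circle.exp (a + 2 * Real.pi)) =
      tourPotential hF σ (Circle.exp a) := by rw [Circle.exp_add_two_pi]
  have hIm : {y | tourPotential hF σ y = 0} =
      Circle.exp '' {t ∈ Icc a (a + 2 * Real.pi) | tourPotential hF σ (Circle.exp t) = 0} := by
    ext y
    constructor
    · intro hy
      have : y ∈ Circle.exp '' Icc a (a + 2 * Real.pi) := by
        rw [Circle.periodic_exp.image_Icc Real.two_pi_pos]
        obtain ⟨t, -, ht⟩ := Circle.surjOn_exp_neg_pi_pi (mem_univ y)
        exact ⟨t, ht⟩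
      obtain ⟨t, ht, rfl⟩ := this
      exact ⟨t, ⟨ht, hy⟩, rfl⟩
    · rintro ⟨t, ⟨-, ht⟩, rfl⟩
      exact ht
  have hexpinj : InjOn Circle.exp
      {t ∈ Icc a (a + 2 * Real.pi) | tourPotential hF σ (Circle.exp t) = 0} := by
    rintro t ⟨ht, ht0⟩ t' ⟨ht', ht0'⟩ h
    have h1 : t < a + 2 * Real.pi := ht.2.lt_of_ne fun h => ha (hper ▸ h ▸ ht0)
    have h1' : t' < a + 2 * Real.pi := ht'.2.lt_of_ne fun h => ha (hper ▸ h ▸ ht0')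
    obtain ⟨m, hm⟩ := Circle.exp_eq_exp.1 h
    have hpi := Real.two_pi_pos
    have hm1 : (m : ℝ) < 1 := by
      by_contra hcon
      nlinarith [ht.1, ht'.1]
    have hm2 : (-1 : ℝ) < m := by
      by_contra hcon
      nlinarith [ht.1, ht'.1]
    have : m = 0 := by
      have h3 : m < 1 := by exact_mod_cast hm1
      have h4 : -1 < m := by exact_mod_cast hm2
      omega
    simpa [this] using hm
  have hfin' := (Set.finite_image_iff hexpinj).1 (hIm ▸ hfin)
  have hcard' := hexpinj.ncard_image
  rw [← hIm, hcard] at hcard'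
  have hcont : Continuous fun t : ℝ => tourPotential hF σ (Circle.exp t) :=
    hc.comp Circle.exp.continuous
  refine (even_ncard_zeros_iff hcont (b := a + 2 * Real.pi) (by rw [hper]; exact ha) _ a
    (by linarith [Real.two_pi_pos]) ha hfin' hcard'.symm fun z hz hz0 => ?_).2 ?_
  · -- near a zero, the tour runs injectively along an edge of the cut
    obtain ⟨e, he, hez⟩ : Circle.exp z ∈ x '' {e | (e : Sym2 V) ∈ cut G A} := by
      rw [← hzero]; exact hz0
    have hopen : IsOpen (SeparationQuotient.mk '' (Pt.inner e '' univ : Set (ETOP' G))) :=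
      SeparationQuotient.isOpenMap_mk _
        (TopologicalSpace.isOpen_generateFrom_of_mem (Or.inl ⟨e, _, isOpen_univ, rfl⟩))
    have hpre := hopen.preimage (hσ.1.comp Circle.exp.continuous)
    have hmem : z ∈ (σ ∘ Circle.exp) ⁻¹'
        (SeparationQuotient.mk '' (Pt.inner e '' univ : Set (ETOP' G))) := by
      refine ⟨_, ⟨half, trivial, rfl⟩, ?_⟩
      rw [Function.comp, ← hez, hx e]
    obtain ⟨δ, hδ, hball⟩ := Metric.isOpen_iff.1 hpre z hmem
    -- The cap `1` makes the interval shorter than `2π`, so that `Circle.exp` is injective on it.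
    refine ⟨min δ 1, lt_min hδ one_pos, fun t ht t' ht' htt => ?_⟩
    have hb : ∀ s ∈ Ioo (z - min δ 1) (z + min δ 1), ∃ r,
        σ (Circle.exp s) = SeparationQuotient.mk (Pt.inner e r : ETOP' G) := by
      intro s hs
      obtain ⟨_, ⟨r, -, rfl⟩, hr⟩ := hball (show s ∈ Metric.ball z δ by
        rw [Metric.mem_ball, Real.dist_eq, abs_lt]
        constructor <;> linarith [hs.1, hs.2, min_le_left δ 1])
      exact ⟨r, hr.symm⟩
    obtain ⟨r, hr⟩ := hb t ht
    obtain ⟨r', hr'⟩ := hb t' ht'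
    simp only at htt
    rw [tourPotential_eq hF hr, tourPotential_eq hF hr'] at htt
    obtain ⟨u, w, hu, hw, hadj, hee⟩ := id he
    have hue : u ∈ (e : Sym2 V) := by rw [hee]; simp
    rw [cutPotential_of_mem_cut he r hue hu, cutPotential_of_mem_cut he r' hue hu] at htt
    have hrr : r = r' := distIn_injective e u (by simp only; linarith)
    subst hrr
    have hexp : Circle.exp t = Circle.exp t' := (hσ.2 e r).unique hr hr'
    obtain ⟨m, hm⟩ := Circle.exp_eq_exp.1 hexp
    have hpi := Real.pi_gt_three
    have h1 := min_le_right δ 1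
    have hm1 : (m : ℝ) < 1 := by
      by_contra hcon
      nlinarith [ht.1, ht'.1, ht.2, ht'.2]
    have hm2 : (-1 : ℝ) < m := by
      by_contra hcon
      nlinarith [ht.1, ht'.1, ht.2, ht'.2]
    have : m = 0 := by
      have h3 : m < 1 := by exact_mod_cast hm1
      have h4 : -1 < m := by exact_mod_cast hm2
      omega
    simpa [this] using hm
  · rw [hper]
    exact mul_self_pos.2 ha

/-- The vertex set of a component has an empty cut, whose potential takes no values but `1/2` and
`-1/2`. If the tour met edges inside and outside the component, the intermediate value theorem would
produce a zero. -/
theorem IsTopologicalEulerTour.reachable (hσ : IsTopologicalEulerTour G σ) {u u' v w : V}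
    (hu : G.Adj u u') (hv : G.Adj v w) : G.Reachable u v := by
  by_contra hnot
  have hcut := cut_reachable G u
  have hF : (cut G {v | G.Reachable u v}).Finite := by rw [hcut]; exact finite_empty
  have hc : Continuous fun t : ℝ => tourPotential hF σ (Circle.exp t) :=
    (continuous_tourPotential hF hσ.1).comp Circle.exp.continuous
  have hval : ∀ {a b : V} (h : G.Adj a b), ∃ t : ℝ, tourPotential hF σ (Circle.exp t) =
      cutPotential G {v | G.Reachable u v}
        (Pt.inner ⟨s(a, b), h⟩ ⟨1 / 2, by norm_num, by norm_num⟩) := by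
    intro a b h
    obtain ⟨y, hy, -⟩ := hσ.2 ⟨s(a, b), h⟩ ⟨1 / 2, by norm_num, by norm_num⟩
    obtain ⟨t, -, rfl⟩ := Circle.surjOn_exp_neg_pi_pi (mem_univ y)
    exact ⟨t, tourPotential_eq hF hy⟩
  obtain ⟨t, ht⟩ := hval hu
  obtain ⟨t', ht'⟩ := hval hv
  have h1 : tourPotential hF σ (Circle.exp t) = 1 / 2 := by
    rw [ht]
    simp only [cutPotential, hcut, mem_empty_iff_false]
    rw [dif_neg id, if_pos ⟨u, by simp, SimpleGraph.Reachable.refl u⟩]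
  have h2 : tourPotential hF σ (Circle.exp t') = -1 / 2 := by
    rw [ht']
    simp only [cutPotential, hcut, mem_empty_iff_false]
    rw [dif_neg id, if_neg]
    rintro ⟨y, hy, hyA⟩
    rcases Sym2.mem_iff.1 hy with rfl | rfl
    · exact hnot hyA
    · exact hnot (SimpleGraph.Reachable.trans hyA hv.symm.reachable)
  obtain ⟨r, hr⟩ := mem_range_of_exists_le_of_exists_ge hc (c := 0) ⟨t', by rw [h2]; norm_num⟩
    ⟨t, by rw [h1]; norm_num⟩
  obtain ⟨p, hp⟩ := SeparationQuotient.surjective_mk (σ (Circle.exp r))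
  have hr : tourPotential hF σ (Circle.exp r) = 0 := hr
  rw [tourPotential_eq hF hp.symm] at hr
  obtain ⟨e, -, -, he, -⟩ := cutPotential_eq_zero hr
  rw [hcut] at he
  exact he

end EulerTour

/-! ### Components after deleting an edge -/

/-- The component of `C` at `w`, as a spanning subgraph. -/
def compAt (C : SimpleGraph V) (w : V) : SimpleGraph V where
  Adj u v := C.Adj u v ∧ C.Reachable w u
  symm := ⟨fun _ _ h => ⟨h.1.symm, h.2.trans h.1.reachable⟩⟩
  loopless := ⟨fun _ h => h.1.ne rfl⟩

theorem compAt_adj {C : SimpleGraph V} {w u v : V} :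
    (compAt C w).Adj u v ↔ C.Adj u v ∧ C.Reachable w u := Iff.rfl

theorem compAt_reachable {C : SimpleGraph V} {w v : V} (h : C.Reachable w v) :
    (compAt C w).Reachable w v := by
  have key : ∀ {a b : V} (p : C.Walk a b), C.Reachable w a → (compAt C w).Reachable a b := by
    intro a b p
    induction p with
    | nil => exact fun _ => SimpleGraph.Reachable.refl _
    | cons h p ih =>
      intro ha
      have h1 : (compAt C w).Adj _ _ := ⟨h, ha⟩
      exact h1.reachable.trans (ih (ha.trans h.reachable))
  obtain ⟨p⟩ := h
  exact key p (SimpleGraph.Reachable.refl w)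

/-- Cuts of a component are cuts of the whole graph; this is how the parity condition is inherited
by components. -/
theorem cut_compAt (C : SimpleGraph V) (w : V) (A : Set V) :
    cut (compAt C w) A = cut C (A ∩ {v | C.Reachable w v}) := by
  ext e
  constructor
  · rintro ⟨u, v, hu, hv, h, rfl⟩
    exact ⟨u, v, ⟨hu, h.2⟩, fun h' => hv h'.1, h.1, rfl⟩
  · rintro ⟨u, v, hu, hv, h, rfl⟩
    exact ⟨u, v, hu.1, fun h' => hv ⟨h', SimpleGraph.Reachable.trans hu.2 h.reachable⟩,
      ⟨h, hu.2⟩, rfl⟩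

theorem EvenCuts.compAt {C : SimpleGraph V} {a b w : V} (h : EvenCuts C a b)
    (hw : C.Reachable w a) : EvenCuts (compAt C w) a b := by
  intro A hA
  rw [cut_compAt] at hA ⊢
  have hb : C.Reachable w b := hw.trans h.reachable
  rw [h _ hA]
  simp [hw, hb]

/-- A component that misses `a` also misses `b`, so none of its cuts separates the two in `C`, and
all its finite cuts are even. -/
theorem EvenCuts.compAt_of_not {C : SimpleGraph V} {a b w : V} (h : EvenCuts C a b)
    (hw : ¬ C.Reachable w a) (c : V) : EvenCuts (InfGraph.compAt C w) c c := by
  intro A hA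
  rw [cut_compAt] at hA ⊢
  have hb : ¬ C.Reachable w b := fun hb => hw (hb.trans h.reachable.symm)
  rw [h _ hA]
  simp [hw, hb]

theorem cut_deleteEdges (C : SimpleGraph V) (e : Sym2 V) (A : Set V) :
    cut (C.deleteEdges {e}) A = cut C A \ {e} := by
  ext f
  constructor
  · rintro ⟨u, v, hu, hv, h, rfl⟩
    rw [SimpleGraph.deleteEdges_adj] at h
    exact ⟨⟨u, v, hu, hv, h.1, rfl⟩, h.2⟩
  · rintro ⟨⟨u, v, hu, hv, h, rfl⟩, h2⟩
    exact ⟨u, v, hu, hv, SimpleGraph.deleteEdges_adj.2 ⟨h, h2⟩, rfl⟩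

/-- This is the removal of the first edge of a trail from `x` to `y`: the parity changes exactly for
the cuts that contain `xz`, which are those separating `x` from `z`. -/
theorem EvenCuts.deleteEdge {C : SimpleGraph V} {x y z : V} (h : EvenCuts C x y)
    (hz : C.Adj x z) : EvenCuts (C.deleteEdges {s(x, z)}) z y := by
  intro A hA
  rw [cut_deleteEdges] at hA ⊢
  have hfin : (cut C A).Finite := (hA.union (finite_singleton s(x, z))).subset fun e he => by
    by_cases hee : e = s(x, z)
    · exact Or.inr hee
    · exact Or.inl ⟨he, hee⟩
  have h1 := h A hfin
  have h2 := mem_cut_iff (A := A) hz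
  by_cases hm : s(x, z) ∈ cut C A
  · have h3 := ncard_sdiff_singleton_add_one hm hfin
    rw [← h3, Nat.even_add_one] at h1
    tauto
  · rw [sdiff_singleton_eq_self hm, h1]
    tauto

theorem EvenCuts.symm {C : SimpleGraph V} {a b : V} (h : EvenCuts C a b) : EvenCuts C b a :=
  fun A hA => (h A hA).trans Iff.comm

/-- What is left at `w` of a graph `C` after deleting the edge `xz`. -/
def rest (C : SimpleGraph V) (x z w : V) : SimpleGraph V := compAt (C.deleteEdges {s(x, z)}) w

theorem rest_adj {C : SimpleGraph V} {x z w u v : V} : (rest C x z w).Adj u v ↔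
    (C.Adj u v ∧ s(u, v) ≠ s(x, z)) ∧ (C.deleteEdges {s(x, z)}).Reachable w u := by
  rw [rest, compAt_adj, SimpleGraph.deleteEdges_adj]
  rfl

/-! ### Distance to an edge -/

/-- From `x` one can reach an endpoint of `t` in `n` steps. -/
inductive Near (C : SimpleGraph V) (t : Sym2 V) : ℕ → V → Prop
  | base {x : V} : x ∈ t → Near C t 0 x
  | step {x z : V} {n : ℕ} : C.Adj x z → Near C t n z → Near C t (n + 1) x

/-- The distance from a vertex to an edge. -/
noncomputable def edgeDist (C : SimpleGraph V) (t : Sym2 V) (x : V) : ℕ := sInf {n | Near C t n x}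

theorem exists_near {C : SimpleGraph V} {t : Sym2 V} {x v : V} (h : C.Reachable x v) (hv : v ∈ t) :
    ∃ n, Near C t n x := by
  obtain ⟨p⟩ := h
  induction p with
  | nil => exact ⟨0, Near.base hv⟩
  | cons h p ih =>
    obtain ⟨n, hn⟩ := ih hv
    exact ⟨n + 1, Near.step h hn⟩

theorem edgeDist_le {C : SimpleGraph V} {t : Sym2 V} {n : ℕ} {x : V} (h : Near C t n x) :
    edgeDist C t x ≤ n := Nat.sInf_le h

theorem near_edgeDist {C : SimpleGraph V} {t : Sym2 V} {n : ℕ} {x : V} (h : Near C t n x) :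
    Near C t (edgeDist C t x) x := Nat.sInf_mem (s := {n | Near C t n x}) ⟨n, h⟩

/-- All vertices on a shortest way from `v` to `t` are closer to `t` than `x` is. So the way avoids
`x` and survives the deletion of `xz`, and `t` itself is not `xz`. -/
theorem near_rest {C : SimpleGraph V} {t : Sym2 V} (ht : t ∈ C.edgeSet) {x z : V} (k : ℕ) :
    ∀ v, Near C t k v → edgeDist C t v = k → k < edgeDist C t x →
      (C.deleteEdges {s(x, z)}).Reachable z v →
      Near (rest C x z z) t k v ∧ t ∈ (rest C x z z).edgeSet := by
  induction k with
  | zero =>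
    intro v hv hd hk hr
    have hvt : v ∈ t := by cases hv; assumption
    refine ⟨Near.base hvt, ?_⟩
    obtain ⟨w, rfl⟩ := Sym2.mem_iff_exists.1 hvt
    refine rest_adj.2 ⟨⟨ht, fun h => ?_⟩, hr⟩
    have hx : x ∈ s(v, w) := h ▸ Sym2.mem_mk_left x z
    have := edgeDist_le (C := C) (Near.base hx)
    omega
  | succ k ih =>
    intro v hv hd hk hr
    obtain ⟨w, hadj, hw⟩ : ∃ w, C.Adj v w ∧ Near C t k w := by
      cases hv with | step h1 h2 => exact ⟨_, h1, h2⟩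
    have hdw : edgeDist C t w = k := by
      have h1 := edgeDist_le hw
      have h2 := edgeDist_le (Near.step hadj (near_edgeDist hw))
      omega
    have hne : s(v, w) ≠ s(x, z) := by
      intro h
      have hx : x ∈ s(v, w) := h ▸ Sym2.mem_mk_left x z
      rcases Sym2.mem_iff.1 hx with rfl | rfl <;> omega
    have hadj' : (C.deleteEdges {s(x, z)}).Adj v w := SimpleGraph.deleteEdges_adj.2 ⟨hadj, hne⟩
    obtain ⟨h1, h2⟩ := ih w hw hdw (by omega) (hr.trans hadj'.reachable)
    exact ⟨Near.step (rest_adj.2 ⟨⟨hadj, hne⟩, hr⟩) h1, h2⟩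

/-- One can walk from `x` towards the edge `t` in such a way that the part of the graph that
contains `t` remains accessible. -/
theorem exists_step_towards {C : SimpleGraph V} {t : Sym2 V} (ht : t ∈ C.edgeSet) {x v : V}
    (hv : v ∈ t) (hr : C.Reachable x v) : ∃ z, C.Adj x z ∧ (s(x, z) = t ∨
      t ∈ (rest C x z z).edgeSet ∧ edgeDist (rest C x z z) t z < edgeDist C t x) := by
  obtain ⟨n, hn⟩ := exists_near hr hv
  have hd := near_edgeDist hn
  rcases h : edgeDist C t x with _ | d
  · rw [h] at hd
    have hxt : x ∈ t := by cases hd; assumption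
    obtain ⟨z, rfl⟩ := Sym2.mem_iff_exists.1 hxt
    exact ⟨z, ht, Or.inl rfl⟩
  · rw [h] at hd
    obtain ⟨z, hadj, hz⟩ : ∃ z, C.Adj x z ∧ Near C t d z := by
      cases hd with | step h1 h2 => exact ⟨_, h1, h2⟩
    have hdz : edgeDist C t z = d := by
      have h1 := edgeDist_le hz
      have h2 := edgeDist_le (Near.step hadj (near_edgeDist hz))
      omega
    obtain ⟨h1, h2⟩ := near_rest ht (x := x) (z := z) d z hz hdz (by omega)
      (SimpleGraph.Reachable.refl z)
    exact ⟨z, hadj, Or.inr ⟨h2, Nat.lt_succ_of_le (edgeDist_le h1)⟩⟩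

/-! ### Gaps -/

/-- A gap in a partially constructed Hamilton circle of the line graph of `G`. The trail leading to
the gap ends at the vertex `x` with the edge `ex`, the trail leading away from it starts at `y` with
the edge `ey`, and the nontrivial component `C` of the rest of `G` has to be fitted in between. -/
structure Gap (G : SimpleGraph V) where
  C : SimpleGraph V
  x : V
  y : V
  ex : G.edgeSet
  ey : G.edgeSet
  le : C ≤ G
  x_mem : x ∈ (ex : Sym2 V)
  y_mem : y ∈ (ey : Sym2 V)
  ex_notMem : (ex : Sym2 V) ∉ C.edgeSet
  ey_notMem : (ey : Sym2 V) ∉ C.edgeSet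
  conn : ∀ u v, C.Adj u v → C.Reachable x u
  ne_bot : C ≠ ⊥
  even : EvenCuts C x y
  loop : ex = ey → (ex : Sym2 V) = s(x, y)
  sep : ∃ S : Set G.edgeSet, S.Finite ∧ ∀ e f : G.edgeSet, (e : Sym2 V) ∈ C.edgeSet →
    G.lineGraph.Adj e f → f ∈ S ∨ (f : Sym2 V) ∈ C.edgeSet

namespace Gap

variable {G : SimpleGraph V}

/-- The edges to be fitted into the gap. -/
def edges (g : Gap G) : Set G.edgeSet := {e | (e : Sym2 V) ∈ g.C.edgeSet}

theorem edges_nonempty (g : Gap G) : g.edges.Nonempty := by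
  obtain ⟨u, v, h⟩ := SimpleGraph.ne_bot_iff_exists_adj.1 g.ne_bot
  exact ⟨⟨s(u, v), g.le h⟩, h⟩

theorem reachable_of_mem (g : Gap G) {e : Sym2 V} (he : e ∈ g.C.edgeSet) {v : V} (hv : v ∈ e) :
    g.C.Reachable g.x v := by
  obtain ⟨w, rfl⟩ := Sym2.mem_iff_exists.1 hv
  exact g.conn v w he

/-- The same gap, traversed in the opposite direction. -/
def swap (g : Gap G) : Gap G where
  C := g.C
  x := g.y
  y := g.x
  ex := g.ey
  ey := g.ex
  le := g.le
  x_mem := g.y_mem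
  y_mem := g.x_mem
  ex_notMem := g.ey_notMem
  ey_notMem := g.ex_notMem
  conn u v h := g.even.reachable.symm.trans (g.conn u v h)
  ne_bot := g.ne_bot
  even := g.even.symm
  loop h := by rw [h, g.loop h.symm]; exact Sym2.eq_swap
  sep := g.sep

/-- An edge that meets the new component without belonging to it is either outside `g.C`, hence in
the old separator, or the deleted edge `xz`. So the separator grows by a single element and stays
finite. -/
theorem sep_rest (g : Gap G) {z : V} (hz : g.C.Adj g.x z) (w : V) :
    ∃ S : Set G.edgeSet, S.Finite ∧ ∀ e f : G.edgeSet, (e : Sym2 V) ∈ (rest g.C g.x z w).edgeSet →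
      G.lineGraph.Adj e f → f ∈ S ∨ (f : Sym2 V) ∈ (rest g.C g.x z w).edgeSet := by
  obtain ⟨S, hS, h⟩ := g.sep
  refine ⟨insert ⟨s(g.x, z), g.le hz⟩ S, hS.insert _, ?_⟩
  intro e f he hef
  obtain ⟨-, v, hve, hvf⟩ := SimpleGraph.lineGraph_adj_iff_exists.1 hef
  obtain ⟨u, hu⟩ := Sym2.mem_iff_exists.1 hve
  rw [hu] at he
  obtain ⟨⟨h1, -⟩, h2⟩ := rest_adj.1 he
  rcases h e f (by rw [hu]; exact h1) hef with h3 | h3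
  · exact Or.inl (Or.inr h3)
  · by_cases hf : (f : Sym2 V) = s(g.x, z)
    · exact Or.inl (Or.inl (Subtype.ext hf))
    · obtain ⟨w', hw'⟩ := Sym2.mem_iff_exists.1 hvf
      rw [hw'] at h3 hf ⊢
      exact Or.inr (rest_adj.2 ⟨⟨h3, hf⟩, h2⟩)

theorem rest_le (C : SimpleGraph V) (x z w : V) : rest C x z w ≤ C :=
  fun _ _ h => (rest_adj.1 h).1.1

theorem notMem_rest (C : SimpleGraph V) (x z w : V) : s(x, z) ∉ (rest C x z w).edgeSet :=
  fun h => (rest_adj.1 h).1.2 rfl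

theorem rest_conn (C : SimpleGraph V) (x z w : V) (u v : V) (h : (rest C x z w).Adj u v) :
    (rest C x z w).Reachable w u := compAt_reachable (rest_adj.1 h).2

/-- The part of the gap `g` between its first edge `ex` and the new edge `xz`. -/
def leftPart (g : Gap G) {z : V} (hz : g.C.Adj g.x z)
    (hr : ¬ (g.C.deleteEdges {s(g.x, z)}).Reachable g.x z) (hne : rest g.C g.x z g.x ≠ ⊥) :
    Gap G where
  C := rest g.C g.x z g.x
  x := g.x
  y := g.x
  ex := g.ex
  ey := ⟨s(g.x, z), g.le hz⟩
  le := (rest_le _ _ _ _).trans g.le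
  x_mem := g.x_mem
  y_mem := Sym2.mem_mk_left _ _
  ex_notMem h := g.ex_notMem (SimpleGraph.edgeSet_mono (rest_le _ _ _ _) h)
  ey_notMem := notMem_rest _ _ _ _
  conn := rest_conn _ _ _ _
  ne_bot := hne
  even := (g.even.deleteEdge hz).compAt_of_not hr g.x
  -- The new edge `xz` belongs to `g.C` and `ex` does not, so the two ends of this gap are distinct
  -- and the condition is vacuous.
  loop h := absurd (h ▸ hz : (g.ex : Sym2 V) ∈ g.C.edgeSet) g.ex_notMem
  sep := g.sep_rest hz _

/-- The part of the gap `g` between the new edge `xz` and its last edge `ey`. -/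
def rightPart (g : Gap G) {z : V} (hz : g.C.Adj g.x z) (hne : rest g.C g.x z z ≠ ⊥) : Gap G where
  C := rest g.C g.x z z
  x := z
  y := g.y
  ex := ⟨s(g.x, z), g.le hz⟩
  ey := g.ey
  le := (rest_le _ _ _ _).trans g.le
  x_mem := Sym2.mem_mk_right _ _
  y_mem := g.y_mem
  ex_notMem := notMem_rest _ _ _ _
  ey_notMem h := g.ey_notMem (SimpleGraph.edgeSet_mono (rest_le _ _ _ _) h)
  conn := rest_conn _ _ _ _
  ne_bot := hne
  even := (g.even.deleteEdge hz).compAt (SimpleGraph.Reachable.refl z)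
  loop h := absurd (h ▸ hz : (g.ey : Sym2 V) ∈ g.C.edgeSet) g.ey_notMem
  sep := g.sep_rest hz _

/-- If nothing is left between the new edge and the last edge of a gap, they are adjacent. -/
theorem eq_of_rest_eq_bot (g : Gap G) {z : V} (hz : g.C.Adj g.x z) (hbot : rest g.C g.x z z = ⊥) :
    z = g.y := by
  have h := compAt_reachable (g.even.deleteEdge hz).reachable
  change (rest g.C g.x z z).Reachable z g.y at h
  rw [hbot] at h
  exact SimpleGraph.reachable_bot.1 h

variable (ν : G.edgeSet → ℕ)

theorem exists_target (g : Gap G) : ∃ t ∈ g.edges, ∀ f ∈ g.edges, ν t ≤ ν f := by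
  have h : (ν '' g.edges).Nonempty := g.edges_nonempty.image ν
  obtain ⟨t, ht, hmin⟩ := Nat.sInf_mem h
  exact ⟨t, ht, fun f hf => hmin ▸ Nat.sInf_le ⟨f, hf, rfl⟩⟩

/-- The edge to be fitted into the gap that comes first in the enumeration `ν`. -/
noncomputable def target (g : Gap G) : G.edgeSet := (g.exists_target ν).choose

theorem target_mem (g : Gap G) : g.target ν ∈ g.edges := (g.exists_target ν).choose_spec.1

theorem target_le (g : Gap G) {f : G.edgeSet} (hf : f ∈ g.edges) : ν (g.target ν) ≤ ν f :=
  (g.exists_target ν).choose_spec.2 f hf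

/-- The distance of the target from the first vertex of the gap. -/
noncomputable def dist (g : Gap G) : ℕ := edgeDist g.C (g.target ν) g.x

theorem exists_z (g : Gap G) : ∃ z, g.C.Adj g.x z ∧ (s(g.x, z) = g.target ν ∨
    (g.target ν : Sym2 V) ∈ (rest g.C g.x z z).edgeSet ∧
      edgeDist (rest g.C g.x z z) (g.target ν) z < g.dist ν) :=
  exists_step_towards (g.target_mem ν) (Sym2.out_fst_mem _)
    (g.reachable_of_mem (g.target_mem ν) (Sym2.out_fst_mem _))

/-- The end of the edge that is added next to the trail leading to the gap. -/
noncomputable def z (g : Gap G) : V := (g.exists_z ν).choose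

theorem adj_z (g : Gap G) : g.C.Adj g.x (g.z ν) := (g.exists_z ν).choose_spec.1

theorem z_spec (g : Gap G) : s(g.x, g.z ν) = g.target ν ∨
    (g.target ν : Sym2 V) ∈ (rest g.C g.x (g.z ν) (g.z ν)).edgeSet ∧
      edgeDist (rest g.C g.x (g.z ν) (g.z ν)) (g.target ν) (g.z ν) < g.dist ν :=
  (g.exists_z ν).choose_spec.2

/-- The edge that is added next to the trail leading to the gap. -/
noncomputable def mid (g : Gap G) : G.edgeSet := ⟨s(g.x, g.z ν), g.le (g.adj_z ν)⟩

theorem mid_mem (g : Gap G) : g.mid ν ∈ g.edges := g.adj_z ν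

theorem ex_notMem_edges (g : Gap G) : g.ex ∉ g.edges := g.ex_notMem

theorem ey_notMem_edges (g : Gap G) : g.ey ∉ g.edges := g.ey_notMem

theorem ex_ne_mid (g : Gap G) : g.ex ≠ g.mid ν := fun h => g.ex_notMem_edges (h ▸ g.mid_mem ν)

theorem mid_ne_ey (g : Gap G) : g.mid ν ≠ g.ey := fun h => g.ey_notMem_edges (h ▸ g.mid_mem ν)

theorem adj_ex_mid (g : Gap G) : G.lineGraph.Adj g.ex (g.mid ν) :=
  SimpleGraph.lineGraph_adj_iff_exists.2 ⟨g.ex_ne_mid ν, g.x, g.x_mem, Sym2.mem_mk_left _ _⟩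

theorem adj_mid_ey (g : Gap G) (h : rest g.C g.x (g.z ν) (g.z ν) = ⊥) :
    G.lineGraph.Adj (g.mid ν) g.ey := by
  refine SimpleGraph.lineGraph_adj_iff_exists.2 ⟨g.mid_ne_ey ν, g.y, ?_, g.y_mem⟩
  rw [← g.eq_of_rest_eq_bot (g.adj_z ν) h]
  exact Sym2.mem_mk_right _ _

end Gap

/-- A cell of a partially constructed Hamilton circle: a gap, or an edge of the line graph. -/
inductive Cell (G : SimpleGraph V) : Type u
  | gap (g : Gap G)
  | edge (e f : G.edgeSet) (h : G.lineGraph.Adj e f)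

namespace Cell

variable {G : SimpleGraph V}

/-- The edges of `G` that are still to be fitted into a cell. -/
def edges : Cell G → Set G.edgeSet
  | gap g => g.edges
  | edge _ _ _ => ∅

/-- The edge of `G` at which a cell starts. -/
def e0 : Cell G → G.edgeSet
  | gap g => g.ex
  | edge e _ _ => e

/-- The edge of `G` at which a cell ends. -/
def e1 : Cell G → G.edgeSet
  | gap g => g.ey
  | edge _ f _ => f

/-- The same cell, traversed in the opposite direction. -/
def swap : Cell G → Cell G
  | gap g => gap g.swap
  | edge e f h => edge f e h.symm

@[simp] theorem swap_e0 (c : Cell G) : c.swap.e0 = c.e1 := by cases c <;> rfl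

@[simp] theorem swap_e1 (c : Cell G) : c.swap.e1 = c.e0 := by cases c <;> rfl

@[simp] theorem swap_edges (c : Cell G) : c.swap.edges = c.edges := by cases c <;> rfl

end Cell

/-! ### Resolving a gap by inserting one edge -/

namespace Gap

variable {G : SimpleGraph V} (ν : G.edgeSet → ℕ)

open Classical in
/-- The cell between the first edge of a gap and the new edge. -/
noncomputable def left (g : Gap G) : Cell G :=
  -- If `xz` is not a bridge of `g.C`, what remains at `x` is the same component as at `z` and is
  -- assigned to the right-hand cell only.
  if h : ¬ (g.C.deleteEdges {s(g.x, g.z ν)}).Reachable g.x (g.z ν) ∧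
      rest g.C g.x (g.z ν) g.x ≠ ⊥ then
    Cell.gap (g.leftPart (g.adj_z ν) h.1 h.2)
  else Cell.edge g.ex (g.mid ν) (g.adj_ex_mid ν)

open Classical in
/-- The cell between the new edge and the last edge of a gap. -/
noncomputable def right (g : Gap G) : Cell G :=
  if h : rest g.C g.x (g.z ν) (g.z ν) ≠ ⊥ then Cell.gap (g.rightPart (g.adj_z ν) h)
  else Cell.edge (g.mid ν) g.ey (g.adj_mid_ey ν (not_not.1 h))

@[simp] theorem left_e0 (g : Gap G) : (g.left ν).e0 = g.ex := by
  unfold left; split_ifs <;> rfl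

@[simp] theorem left_e1 (g : Gap G) : (g.left ν).e1 = g.mid ν := by
  unfold left; split_ifs <;> rfl

@[simp] theorem right_e0 (g : Gap G) : (g.right ν).e0 = g.mid ν := by
  unfold right; split_ifs <;> rfl

@[simp] theorem right_e1 (g : Gap G) : (g.right ν).e1 = g.ey := by
  unfold right; split_ifs <;> rfl

theorem left_edges_subset (g : Gap G) : (g.left ν).edges ⊆ g.edges := by
  unfold left
  split_ifs
  · exact fun e he => SimpleGraph.edgeSet_mono (rest_le _ _ _ _) he
  · exact empty_subset _

theorem right_edges_subset (g : Gap G) : (g.right ν).edges ⊆ g.edges := by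
  unfold right
  split_ifs
  · exact fun e he => SimpleGraph.edgeSet_mono (rest_le _ _ _ _) he
  · exact empty_subset _

theorem mid_notMem_left (g : Gap G) : g.mid ν ∉ (g.left ν).edges := by
  unfold left
  split_ifs
  · exact notMem_rest _ _ _ _
  · exact notMem_empty _

theorem mid_notMem_right (g : Gap G) : g.mid ν ∉ (g.right ν).edges := by
  unfold right
  split_ifs
  · exact notMem_rest _ _ _ _
  · exact notMem_empty _

/-- Deleting one edge from a connected graph leaves only the components of its two endpoints. -/
theorem mem_left_or_right (g : Gap G) {e : G.edgeSet} (he : e ∈ g.edges) (hm : e ≠ g.mid ν) :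
    e ∈ (g.left ν).edges ∨ e ∈ (g.right ν).edges := by
  have hne : (e : Sym2 V) ≠ s(g.x, g.z ν) := fun h => hm (Subtype.ext h)
  obtain ⟨e, heG⟩ := e
  induction e using Sym2.ind with
  | _ u v =>
    set C' := g.C.deleteEdges {s(g.x, g.z ν)} with hC'
    have hadj : C'.Adj u v := SimpleGraph.deleteEdges_adj.2 ⟨he, hne⟩
    have hor : C'.Reachable g.x u ∨ C'.Reachable (g.z ν) u := by
      have hpath : ∀ {a b : V} (p : g.C.Walk a b), C'.Reachable a b ∨ C'.Reachable g.x b ∨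
          C'.Reachable (g.z ν) b := by
        intro a b p
        induction p with
        | nil => exact Or.inl (SimpleGraph.Reachable.refl _)
        | @cons a c b h p ih =>
          rcases ih with ih | ih
          · by_cases hac : s(a, c) = s(g.x, g.z ν)
            · rcases Sym2.eq_iff.1 hac with ⟨-, rfl⟩ | ⟨-, rfl⟩
              · exact Or.inr (Or.inr ih)
              · exact Or.inr (Or.inl ih)
            · have : C'.Adj a c := SimpleGraph.deleteEdges_adj.2 ⟨h, hac⟩
              exact Or.inl (this.reachable.trans ih)
          · exact Or.inr ih
      obtain ⟨p⟩ := g.conn u v he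
      have := hpath p
      tauto
    by_cases hz : C'.Reachable (g.z ν) u
    · right
      have h1 : (rest g.C g.x (g.z ν) (g.z ν)).Adj u v := ⟨hadj, hz⟩
      have h2 : rest g.C g.x (g.z ν) (g.z ν) ≠ ⊥ := SimpleGraph.ne_bot_iff_exists_adj.2 ⟨u, v, h1⟩
      rw [right, dif_pos h2]
      exact h1
    · left
      have hx := hor.resolve_right hz
      have h1 : (rest g.C g.x (g.z ν) g.x).Adj u v := ⟨hadj, hx⟩
      have h2 : rest g.C g.x (g.z ν) g.x ≠ ⊥ := SimpleGraph.ne_bot_iff_exists_adj.2 ⟨u, v, h1⟩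
      rw [left, dif_pos ⟨fun h => hz (h.symm.trans hx), h2⟩]
      exact h1

theorem left_reachable {g : Gap G} {e : G.edgeSet} (he : e ∈ (g.left ν).edges) {v : V}
    (hv : v ∈ (e : Sym2 V)) :
    ¬ (g.C.deleteEdges {s(g.x, g.z ν)}).Reachable (g.z ν) v := by
  unfold left at he
  split_ifs at he with h
  · obtain ⟨w, hw⟩ := Sym2.mem_iff_exists.1 hv
    have he' : (e : Sym2 V) ∈ (rest g.C g.x (g.z ν) g.x).edgeSet := he
    rw [hw] at he'
    exact fun h' => h.1 ((rest_adj.1 he').2.trans h'.symm)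
  · exact absurd he (notMem_empty _)

theorem right_reachable {g : Gap G} {e : G.edgeSet} (he : e ∈ (g.right ν).edges) {v : V}
    (hv : v ∈ (e : Sym2 V)) :
    (g.C.deleteEdges {s(g.x, g.z ν)}).Reachable (g.z ν) v := by
  unfold right at he
  split_ifs at he with h
  · obtain ⟨w, hw⟩ := Sym2.mem_iff_exists.1 hv
    have he' : (e : Sym2 V) ∈ (rest g.C g.x (g.z ν) (g.z ν)).edgeSet := he
    rw [hw] at he'
    exact (rest_adj.1 he').2
  · exact absurd he (notMem_empty _)

/-- Edges remain on the left only when `xz` is a bridge; the two sides then lie in different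
components and share no vertex. -/
theorem left_right_disjoint {g : Gap G} {e f : G.edgeSet} (he : e ∈ (g.left ν).edges)
    (hf : f ∈ (g.right ν).edges) : e ≠ f ∧ ¬ G.lineGraph.Adj e f := by
  constructor
  · rintro rfl
    exact left_reachable ν he (Sym2.out_fst_mem _) (right_reachable ν hf (Sym2.out_fst_mem _))
  · intro h
    obtain ⟨-, v, hve, hvf⟩ := SimpleGraph.lineGraph_adj_iff_exists.1 h
    exact left_reachable ν he hve (right_reachable ν hf hvf)

/-- The relation between a gap and the gaps in which it is resolved. -/
def Child (g g' : Gap G) : Prop :=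
  g.left ν = Cell.gap g' ∨ g.right ν = Cell.gap g' ∧ g.mid ν ≠ g.target ν ∨
    g.right ν = Cell.gap g'.swap ∧ g.mid ν = g.target ν

theorem target_mem_right {g : Gap G} (h : g.mid ν ≠ g.target ν) :
    g.target ν ∈ (g.right ν).edges := by
  have h1 := ((g.z_spec ν).resolve_left fun h' => h (Subtype.ext h')).1
  have h2 : rest g.C g.x (g.z ν) (g.z ν) ≠ ⊥ := by
    intro hb
    rw [hb] at h1
    simp at h1
  rw [right, dif_pos h2]
  exact h1

variable {ν}

theorem target_eq (hν : Function.Injective ν) {g g' : Gap G} (hsub : g'.edges ⊆ g.edges)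
    (h : g.target ν ∈ g'.edges) : g'.target ν = g.target ν :=
  hν (le_antisymm (g'.target_le ν h) (g.target_le ν (hsub (g'.target_mem ν))))

theorem target_lt (hν : Function.Injective ν) {g g' : Gap G} (hsub : g'.edges ⊆ g.edges)
    (h : g.target ν ∉ g'.edges) : ν (g.target ν) < ν (g'.target ν) :=
  (g.target_le ν (hsub (g'.target_mem ν))).lt_of_ne fun h' => h (hν h' ▸ g'.target_mem ν)

theorem right_gap_dist (hν : Function.Injective ν) {g g' : Gap G} (h : g.right ν = Cell.gap g')
    (hm : g.mid ν ≠ g.target ν) : g'.target ν = g.target ν ∧ g'.dist ν < g.dist ν := by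
  have h1 := target_mem_right ν hm
  have hsub := g.right_edges_subset ν
  rw [h] at h1 hsub
  have h2 := target_eq hν hsub h1
  refine ⟨h2, ?_⟩
  have h3 := ((g.z_spec ν).resolve_left fun h' => hm (Subtype.ext h')).2
  rw [dist, h2]
  unfold right at h
  split_ifs at h with hne
  injection h with h
  subst h
  exact h3

theorem Child.edges_subset {g g' : Gap G} (h : Child ν g g') : g'.edges ⊆ g.edges := by
  rcases h with h | ⟨h, -⟩ | ⟨h, -⟩
  · have := g.left_edges_subset ν
    rwa [h] at this
  · have := g.right_edges_subset ν
    rwa [h] at this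
  · have := g.right_edges_subset ν
    rwa [h] at this

/-- The target is either the inserted edge or still missing on the right. So a left child and a
reversed right child have lost it and have a later target, while an unreversed right child keeps it
and has moved closer. -/
theorem Child.progress (hν : Function.Injective ν) {g g' : Gap G} (h : Child ν g g') :
    ν (g.target ν) < ν (g'.target ν) ∨ ν (g'.target ν) = ν (g.target ν) ∧ g'.dist ν < g.dist ν := by
  have hsub := h.edges_subset
  rcases h with h | ⟨h, hm⟩ | ⟨h, hm⟩
  · refine Or.inl (target_lt hν hsub fun ht => ?_)
    have ht' : g.target ν ∈ (g.left ν).edges := by rw [h]; exact ht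
    by_cases hm : g.mid ν = g.target ν
    · exact g.mid_notMem_left ν (hm ▸ ht')
    · exact (left_right_disjoint ν ht' (target_mem_right ν hm)).1 rfl
  · obtain ⟨h1, h2⟩ := right_gap_dist hν h hm
    exact Or.inr ⟨congrArg ν h1, h2⟩
  · refine Or.inl (target_lt hν hsub fun ht => ?_)
    have ht' : g.target ν ∈ (g.right ν).edges := by rw [h]; exact ht
    exact g.mid_notMem_right ν (hm ▸ ht')

/-- No edge has to wait forever. -/
theorem wellFounded_child (hν : Function.Injective ν) (f : G.edgeSet) :
    WellFounded fun g' g : Gap G => Child ν g g' ∧ f ∈ g'.edges := by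
  -- As long as `f` is missing, the target does not come after `f`, so the truncated difference `ν f
  -- - ν (target)` really drops when the target advances.
  refine Subrelation.wf (r := InvImage (Prod.Lex (· < ·) (· < ·))
    fun g : Gap G => (ν f - ν (g.target ν), g.dist ν)) ?_ (InvImage.wf _ (Prod.instWellFoundedRelation.wf : WellFounded (Prod.Lex (· < · : ℕ → ℕ → Prop) (· < · : ℕ → ℕ → Prop))))
  rintro g' g ⟨h, hf⟩
  have h1 := g'.target_le ν hf
  rcases h.progress hν with h2 | ⟨h2, h3⟩
  · exact Prod.Lex.left _ _ (by omega)
  · simp only [InvImage]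
    rw [h2]
    exact Prod.Lex.right _ h3

theorem exists_notMem_of_branch (hν : Function.Injective ν) {s : ℕ → Gap G}
    (hs : ∀ n, Child ν (s n) (s (n + 1))) (f : G.edgeSet) : ∃ n, f ∉ (s n).edges := by
  by_contra! h
  exact (wellFounded_iff_isEmpty_descending_chain.1 (wellFounded_child hν f)).false
    ⟨s, fun n => ⟨hs n, h (n + 1)⟩⟩

/-- A gap at whose two ends there is the same vertex of `G` has no left part. -/
theorem left_of_x_eq_y {g : Gap G} (h : g.x = g.y) :
    g.left ν = Cell.edge g.ex (g.mid ν) (g.adj_ex_mid ν) := by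
  rw [left, dif_neg]
  rintro ⟨h1, -⟩
  apply h1
  have := (g.even.deleteEdge (g.adj_z ν)).reachable
  rw [← h] at this
  exact this.symm

theorem left_gap {g g' : Gap G} (h : g.left ν = Cell.gap g') :
    g'.x = g'.y ∧ g'.ex = g.ex ∧ g'.ey = g.mid ν := by
  unfold left at h
  split_ifs at h with hne
  injection h with h
  subst h
  exact ⟨rfl, rfl, rfl⟩

theorem right_gap {g g' : Gap G} (h : g.right ν = Cell.gap g') :
    g'.ex = g.mid ν ∧ g'.ey = g.ey := by
  have h1 := g.right_e0 ν
  have h2 := g.right_e1 ν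
  rw [h] at h1 h2
  exact ⟨h1, h2⟩

theorem Child.ends {g g' : Gap G} (h : Child ν g g') :
    g'.ex = g.ex ∧ g'.ey = g.mid ν ∧ g'.x = g'.y ∨
    g'.ex = g.mid ν ∧ g'.ey = g.ey ∧ g.right ν = Cell.gap g' ∧ g.mid ν ≠ g.target ν ∨
    g'.ex = g.ey ∧ g'.ey = g.mid ν := by
  rcases h with h | ⟨h, hm⟩ | ⟨h, hm⟩
  · obtain ⟨h1, h2, h3⟩ := left_gap h
    exact Or.inl ⟨h2, h3, h1⟩
  · obtain ⟨h1, h2⟩ := right_gap h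
    exact Or.inr (Or.inl ⟨h1, h2, h, hm⟩)
  · obtain ⟨h1, h2⟩ := right_gap h
    exact Or.inr (Or.inr ⟨h2, h1⟩)

end Gap

/-! ### Rays in nested connected sets -/

section NestedRay

variable {W : Type u} {L : SimpleGraph W}

/-- A walk that pauses and visits every vertex only finitely often contains a ray. -/
theorem exists_ray_of_walk {w : ℕ → W} (hw : ∀ i, w i = w (i + 1) ∨ L.Adj (w i) (w (i + 1)))
    (hfin : ∀ i, {j | w j = w i}.Finite) :
    ∃ (R : Ray L) (φ : ℕ → ℕ), StrictMono φ ∧ ∀ k, R.vert k = w (φ k) := by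
  have hlast : ∀ i, ∃ j, w j = w i ∧ ∀ k, w k = w i → k ≤ j := fun i => by
    obtain ⟨j, hj, hmax⟩ := Set.exists_max_image _ id (hfin i) ⟨i, rfl⟩
    exact ⟨j, hj, hmax⟩
  choose last hl hmax using hlast
  -- The sequence `φ` jumps from one last visit to the next: after the last visit to a vertex the
  -- walk moves on, and the vertex reached is followed to its own last visit. So consecutive terms
  -- are adjacent and no vertex recurs.
  let φ : ℕ → ℕ := fun k => Nat.rec (last 0) (fun _ i => last (i + 1)) k
  have hφ : ∀ k, φ (k + 1) = last (φ k + 1) := fun _ => rfl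
  have hφl : ∀ k j, w j = w (φ k) → j ≤ φ k := by
    intro k j hj
    cases k with
    | zero => exact hmax 0 j (hj.trans (hl 0))
    | succ k => exact hmax (φ k + 1) j (hj.trans (hl _))
  have hmono : StrictMono φ := strictMono_nat_of_lt_succ fun k => by
    have := hmax (φ k + 1) (φ k + 1) rfl
    rw [hφ]
    omega
  refine ⟨⟨fun k => w (φ k), fun j k hjk => ?_, fun k => ?_⟩, φ, hmono, fun _ => rfl⟩
  · exact hmono.injective (le_antisymm (hφl k _ hjk) (hφl j _ hjk.symm))
  · rw [hφ, hl]
    refine (hw (φ k)).resolve_left fun h => ?_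
    have := hφl k _ h.symm
    omega

/-- From `a` one can reach the set `K'` in `k` steps inside `K`. -/
inductive ReachSet (L : SimpleGraph W) (K K' : Set W) : ℕ → W → Prop
  | base {a : W} : a ∈ K' → ReachSet L K K' 0 a
  | step {a b : W} {k : ℕ} : L.Adj a b → b ∈ K → ReachSet L K K' k b → ReachSet L K K' (k + 1) a

/-- Inside `K n` walk along a shortest route to `K (n + 1)`, then continue there. Each vertex lies
outside some `K n`, so the walk visits it only finitely often and `exists_ray_of_walk` applies. -/
theorem exists_ray_of_nested {K : ℕ → Set W} (hanti : ∀ n, K (n + 1) ⊆ K n)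
    (hne : ∀ n, (K n).Nonempty)
    (hconn : ∀ n, ∀ a ∈ K n, ∀ b ∈ K n,
      Relation.ReflTransGen (fun u v => L.Adj u v ∧ u ∈ K n ∧ v ∈ K n) a b)
    (hinter : ∀ v, ∃ n, v ∉ K n) : ∃ R : Ray L, ∀ n, ∀ᶠ k in atTop, R.vert k ∈ K n := by
  have hK : Antitone K := antitone_nat_of_succ_le hanti
  have hreach : ∀ n, ∀ a ∈ K n, ∃ k, ReachSet L (K n) (K (n + 1)) k a := by
    intro n a ha
    obtain ⟨b, hb⟩ := hne (n + 1)
    have h := hconn n a ha b (hanti n hb)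
    induction h using Relation.ReflTransGen.head_induction_on with
    | refl => exact ⟨0, ReachSet.base hb⟩
    | head h1 h2 ih =>
      obtain ⟨k, hk⟩ := ih h1.2.2
      exact ⟨k + 1, ReachSet.step h1.1 h1.2.2 hk⟩
  -- one step towards the next set
  have hstep : ∀ p : {p : ℕ × W // p.2 ∈ K p.1}, ∃ q : {p : ℕ × W // p.2 ∈ K p.1},
      (p.1.2 = q.1.2 ∨ L.Adj p.1.2 q.1.2) ∧ (q.1.1 = p.1.1 + 1 ∨ q.1.1 = p.1.1 ∧
        ∀ k, ReachSet L (K p.1.1) (K (p.1.1 + 1)) k p.1.2 →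
          ∃ k' < sInf {k | ReachSet L (K p.1.1) (K (p.1.1 + 1)) k p.1.2},
            ReachSet L (K p.1.1) (K (p.1.1 + 1)) k' q.1.2) := by
    rintro ⟨⟨n, a⟩, ha⟩
    obtain ⟨k, hk⟩ := hreach n a ha
    have hm : ReachSet L (K n) (K (n + 1)) (sInf {k | ReachSet L (K n) (K (n + 1)) k a}) a :=
      Nat.sInf_mem (s := {k | ReachSet L (K n) (K (n + 1)) k a}) ⟨k, hk⟩
    rcases hs : sInf {k | ReachSet L (K n) (K (n + 1)) k a} with _ | d
    · rw [hs] at hm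
      have : a ∈ K (n + 1) := by cases hm; assumption
      exact ⟨⟨⟨n + 1, a⟩, this⟩, Or.inl rfl, Or.inl rfl⟩
    · rw [hs] at hm
      obtain ⟨b, h1, h2, h3⟩ : ∃ b, L.Adj a b ∧ b ∈ K n ∧ ReachSet L (K n) (K (n + 1)) d b := by
        cases hm with | step h1 h2 h3 => exact ⟨_, h1, h2, h3⟩
      refine ⟨⟨⟨n, b⟩, h2⟩, Or.inr h1, Or.inr ⟨rfl, fun _ _ => ⟨d, ?_, h3⟩⟩⟩
      exact Nat.lt_succ_self d
  choose f hf1 hf2 using hstep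
  obtain ⟨a₀, ha₀⟩ := hne 0
  let s : ℕ → {p : ℕ × W // p.2 ∈ K p.1} := fun i => f^[i] ⟨⟨0, a₀⟩, ha₀⟩
  have hs : ∀ i, s (i + 1) = f (s i) := fun i => Function.iterate_succ_apply' f i _
  have hlev : Monotone fun i => (s i).1.1 := monotone_nat_of_le_succ fun i => by
    simp only [hs]
    rcases hf2 (s i) with h | ⟨h, -⟩ <;> omega
  have hup : ∀ k i, ReachSet L (K (s i).1.1) (K ((s i).1.1 + 1)) k (s i).1.2 →
      ∃ j, (s i).1.1 + 1 ≤ (s j).1.1 := by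
    intro k
    induction k using Nat.strong_induction_on with
    | _ k ih =>
      intro i hk
      rcases hf2 (s i) with h | ⟨h, h'⟩
      · exact ⟨i + 1, by rw [hs, h]⟩
      · obtain ⟨k', hk', hr⟩ := h' k hk
        have h3 : k' < k := hk'.trans_le (Nat.sInf_le hk)
        have hh : (s (i + 1)).1.1 = (s i).1.1 := by rw [hs, h]
        obtain ⟨j, hj⟩ := ih k' h3 (i + 1) (by rw [hh, hs]; exact hr)
        exact ⟨j, by rw [hh] at hj; exact hj⟩
  have hunb : ∀ n, ∃ i, n ≤ (s i).1.1 := by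
    intro n
    induction n with
    | zero => exact ⟨0, Nat.zero_le _⟩
    | succ n ih =>
      obtain ⟨i, hi⟩ := ih
      obtain ⟨k, hk⟩ := hreach _ _ (s i).2
      obtain ⟨j, hj⟩ := hup k i hk
      exact ⟨j, by omega⟩
  have hev : ∀ n, ∃ i, ∀ j ≥ i, (s j).1.2 ∈ K n := by
    intro n
    obtain ⟨i, hi⟩ := hunb n
    exact ⟨i, fun j hj => hK (hi.trans (hlev hj)) (s j).2⟩
  obtain ⟨R, φ, hφ, hR⟩ := exists_ray_of_walk (L := L) (w := fun i => (s i).1.2)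
    (fun i => by simp only [hs]; exact hf1 (s i)) (fun i => by
      obtain ⟨n, hn⟩ := hinter (s i).1.2
      obtain ⟨m, hm⟩ := hev n
      refine (Set.finite_lt_nat m).subset fun j hj => ?_
      by_contra hjm
      have h1 := hm j (not_lt.1 hjm)
      have hj : (s j).1.2 = (s i).1.2 := hj
      rw [hj] at h1
      exact hn h1)
  refine ⟨R, fun n => ?_⟩
  obtain ⟨i, hi⟩ := hev n
  filter_upwards [eventually_ge_atTop i] with k hk
  rw [hR]
  exact hi _ (hk.trans (hφ.id_le k))

end NestedRay

/-! ### Branches of nested gaps -/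

namespace Gap

variable {G : SimpleGraph V} {ν : G.edgeSet → ℕ}

theorem edges_connected (g : Gap G) {e f : G.edgeSet} (he : e ∈ g.edges) (hf : f ∈ g.edges) :
    Relation.ReflTransGen (fun a b => G.lineGraph.Adj a b ∧ a ∈ g.edges ∧ b ∈ g.edges) e f := by
  have hone : ∀ {a b : G.edgeSet} {v : V}, a ∈ g.edges → b ∈ g.edges → v ∈ (a : Sym2 V) →
      v ∈ (b : Sym2 V) →
      Relation.ReflTransGen (fun a b => G.lineGraph.Adj a b ∧ a ∈ g.edges ∧ b ∈ g.edges) a b := by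
    intro a b v ha hb hva hvb
    by_cases hab : a = b
    · rw [hab]
    · exact Relation.ReflTransGen.single
        ⟨SimpleGraph.lineGraph_adj_iff_exists.2 ⟨hab, v, hva, hvb⟩, ha, hb⟩
  have key : ∀ {u v : V} (p : g.C.Walk u v) (e : G.edgeSet), e ∈ g.edges → u ∈ (e : Sym2 V) →
      v ∈ (f : Sym2 V) →
      Relation.ReflTransGen (fun a b => G.lineGraph.Adj a b ∧ a ∈ g.edges ∧ b ∈ g.edges) e f := by
    intro u v p
    induction p with
    | nil => exact fun e he hu hv => hone he hf hu hv
    | @cons u w v h p ih =>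
      intro e he hu hv
      let e' : G.edgeSet := ⟨s(u, w), g.le h⟩
      have he' : e' ∈ g.edges := h
      exact (hone he he' hu (Sym2.mem_mk_left u w)).trans (ih e' he' (Sym2.mem_mk_right u w) hv)
  have h1 := g.reachable_of_mem he (Sym2.out_fst_mem (e : Sym2 V))
  have h2 := g.reachable_of_mem hf (Sym2.out_fst_mem (f : Sym2 V))
  obtain ⟨p⟩ := h1.symm.trans h2
  exact key p e he (Sym2.out_fst_mem _) (Sym2.out_fst_mem _)

section Branch

variable {s : ℕ → Gap G}

theorem edges_antitone (hs : ∀ n, Child ν (s n) (s (n + 1))) : Antitone fun n => (s n).edges :=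
  antitone_nat_of_succ_le fun n => (hs n).edges_subset

theorem exists_ray_of_branch (hν : Function.Injective ν) (hs : ∀ n, Child ν (s n) (s (n + 1))) :
    ∃ R : Ray G.lineGraph, ∀ n, ∀ᶠ k in atTop, R.vert k ∈ (s n).edges :=
  exists_ray_of_nested (fun n => (hs n).edges_subset) (fun n => (s n).edges_nonempty)
    (fun n _ ha _ hb => (s n).edges_connected ha hb) (exists_notMem_of_branch hν hs)

/-- The edges at the ends of the gaps of a branch change again and again. -/
theorem exists_ne_ends (hν : Function.Injective ν) (hs : ∀ n, Child ν (s n) (s (n + 1)))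
    (f : G.edgeSet) : ∃ N, ∀ m ≥ N, f ≠ (s m).ex ∧ f ≠ (s m).ey := by
  obtain ⟨n, hn⟩ := exists_notMem_of_branch hν hs f
  have hmid : ∀ m ≥ n, (s m).mid ν ≠ f := fun m hm h =>
    hn (edges_antitone hs hm (h ▸ (s m).mid_mem ν))
  -- An end edge of a child is an end edge of its parent or the inserted edge, and the latter is no
  -- longer `f`. So once `f` has left both ends it never returns.
  suffices h : ∃ m ≥ n, f ≠ (s m).ex ∧ f ≠ (s m).ey by
    obtain ⟨N, hN, h1⟩ := h
    refine ⟨N, fun m hm => ?_⟩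
    induction m, hm using Nat.le_induction with
    | base => exact h1
    | succ m hm ih =>
      have h2 := hmid m (hN.trans hm)
      rcases (hs m).ends with ⟨h3, h4, -⟩ | ⟨h3, h4, -⟩ | ⟨h3, h4⟩ <;> rw [h3, h4]
      · exact ⟨ih.1, h2.symm⟩
      · exact ⟨h2.symm, ih.2⟩
      · exact ⟨ih.2, h2.symm⟩
  by_contra! hcon
  -- `f` cannot be at the first end
  have hex : ∀ m ≥ n, (s m).ey ≠ f → f ≠ (s m).ex := by
    intro m hm hey hfx
    have h2 := hmid m hm
    have h2' := hmid (m + 1) (by omega)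
    have h0 := hcon (m + 1) (by omega)
    have h0' := hcon (m + 2) (by omega)
    rcases (hs m).ends with ⟨h3, h4, h5⟩ | ⟨h3, h4, -⟩ | ⟨h3, h4⟩
    -- After a left step the gap has `x = y`, so the next step goes right. The resulting gap ends at
    -- the two edges inserted last, neither of which is `f`.
    · have h6 := left_of_x_eq_y (ν := ν) h5
      rcases (hs (m + 1)).ends with ⟨-, -, -⟩ | ⟨h7, h8, -⟩ | ⟨h7, h8⟩
      · rcases hs (m + 1) with h | ⟨h, -⟩ | ⟨h, -⟩
        · rw [h6] at h
          cases h
        · obtain ⟨h7, h8⟩ := right_gap h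
          rw [h7, h8, h4] at h0'
          exact h2 (h0' h2'.symm).symm
        · obtain ⟨h7, h8⟩ := right_gap h
          change (s (m + 2)).ey = _ at h7
          change (s (m + 2)).ex = _ at h8
          rw [h7, h8, h4] at h0'
          exact h2' (h0' h2.symm).symm
      · rw [h7, h8, h4] at h0'
        exact h2 (h0' h2'.symm).symm
      · rw [h7, h8, h4] at h0'
        exact h2' (h0' h2.symm).symm
    · rw [h3, h4] at h0
      exact hey (h0 h2.symm).symm
    · rw [h3, h4] at h0
      exact h2 (h0 hey.symm).symm
  have hmidend : ∀ m ≥ n, (s (m + 1)).ex = (s m).mid ν ∨ (s (m + 1)).ey = (s m).mid ν := by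
    intro m hm
    rcases (hs m).ends with ⟨h3, h4, -⟩ | ⟨h3, h4, -⟩ | ⟨h3, h4⟩
    exacts [Or.inr h4, Or.inl h3, Or.inr h4]
  have hey : ∀ m ≥ n + 1, f ≠ (s m).ex := by
    intro m hm
    obtain ⟨m, rfl⟩ : ∃ k, m = k + 1 := ⟨m - 1, by omega⟩
    have h2 := hmid m (by omega)
    rcases hmidend m (by omega) with h | h
    · rw [h]; exact h2.symm
    · exact hex (m + 1) (by omega) (by rw [h]; exact h2)
  -- So `f` stays at the second end. A left step or a reversal would remove it from there, so all
  -- steps go to an unreversed right cell, and the distance to the target would decrease forever.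
  have hdist : ∀ m ≥ n + 1, (s (m + 1)).dist ν < (s m).dist ν := by
    intro m hm
    have h0 := hey m hm
    have h1 := hey (m + 1) (by omega)
    have h2 := hcon (m + 1) (by omega) h1
    have h3 := hmid m (by omega)
    rcases (hs m).ends with ⟨-, h4, -⟩ | ⟨-, -, h4, h5⟩ | ⟨-, h4⟩
    · exact absurd (h2.trans h4).symm h3
    · exact (right_gap_dist hν h4 h5).2
    · exact absurd (h2.trans h4).symm h3
  have hsum : ∀ k, (s (n + 1 + k)).dist ν + k ≤ (s (n + 1)).dist ν := by
    intro k
    induction k with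
    | zero => simp
    | succ k ih =>
      have := hdist (n + 1 + k) (by omega)
      change (s (n + 1 + k + 1)).dist ν + (k + 1) ≤ _
      omega
  have := hsum ((s (n + 1)).dist ν + 1)
  omega

/-- Each end edge of a later gap is an end edge of `s n` or was inserted since, and in the second
case it belongs to `(s n).edges`. The first case stops occurring by `exists_ne_ends`. -/
theorem exists_ends_mem (hν : Function.Injective ν) (hs : ∀ n, Child ν (s n) (s (n + 1))) (n : ℕ) :
    ∃ m ≥ n, (s m).ex ∈ (s n).edges ∧ (s m).ey ∈ (s n).edges := by
  have h : ∀ m ≥ n, ((s m).ex ∈ (s n).edges ∨ (s m).ex = (s n).ex ∨ (s m).ex = (s n).ey) ∧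
      ((s m).ey ∈ (s n).edges ∨ (s m).ey = (s n).ex ∨ (s m).ey = (s n).ey) := by
    intro m hm
    induction m, hm using Nat.le_induction with
    | base => exact ⟨Or.inr (Or.inl rfl), Or.inr (Or.inr rfl)⟩
    | succ m hm ih =>
      have h2 : (s m).mid ν ∈ (s n).edges := edges_antitone hs hm ((s m).mid_mem ν)
      rcases (hs m).ends with ⟨h3, h4, -⟩ | ⟨h3, h4, -⟩ | ⟨h3, h4⟩ <;> rw [h3, h4]
      · exact ⟨ih.1, Or.inl h2⟩
      · exact ⟨Or.inl h2, ih.2⟩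
      · exact ⟨ih.2, Or.inl h2⟩
  obtain ⟨N, hN⟩ := exists_ne_ends hν hs (s n).ex
  obtain ⟨N', hN'⟩ := exists_ne_ends hν hs (s n).ey
  refine ⟨max n (max N N'), le_max_left _ _, ?_⟩
  have h1 := hN (max n (max N N')) ((le_max_left _ _).trans (le_max_right _ _))
  have h2 := hN' (max n (max N N')) ((le_max_right _ _).trans (le_max_right _ _))
  obtain ⟨h3, h4⟩ := h _ (le_max_left n (max N N'))
  exact ⟨h3.resolve_right fun h => h.elim (fun h => h1.1 h.symm) fun h => h2.1 h.symm,
    h4.resolve_right fun h => h.elim (fun h => h1.2 h.symm) fun h => h2.2 h.symm⟩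

end Branch

end Gap

/-! ### The limit map -/

section LimitMap

variable {G : SimpleGraph V} (ν : G.edgeSet → ℕ)

open Classical in
/-- The cell between the new edge and the last edge of a gap, traversed backwards if the new edge
is the target of the gap. -/
noncomputable def Gap.rightCell (g : Gap G) : Cell G :=
  if g.mid ν = g.target ν then (g.right ν).swap else g.right ν

open Classical in
/-- The rescaling of `[1 / 2, 1]` that belongs to `Gap.rightCell`. -/
noncomputable def Gap.coord (g : Gap G) (s : ℝ) : ℝ :=
  if g.mid ν = g.target ν then 2 - 2 * s else 2 * s - 1

/-- Passing from a point of a cell to the same point in the next finer subdivision. -/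
noncomputable def Cell.step : Cell G × ℝ → Cell G × ℝ
  | (Cell.gap g, s) => if s ≤ 1 / 2 then (g.left ν, 2 * s) else (g.rightCell ν, g.coord ν s)
  | (Cell.edge e f h, s) => (Cell.edge e f h, s)

/-- The points to which the subdivisions around a point of a cell converge. -/
def IsVal (p : Cell G × ℝ) (P : MTOP G.lineGraph) : Prop :=
  (∃ n e f h s, (Cell.step ν)^[n] p = (Cell.edge e f h, s) ∧ P = arc h s) ∨
    ∃ R : Ray G.lineGraph, P = Pt.endPt (VertexEnd.mk R) ∧
      ∀ n, ∀ᶠ k in atTop, R.vert k ∈ ((Cell.step ν)^[n] p).1.edges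

/-- The map that describes the part of the Hamilton circle that fills a cell. -/
noncomputable def val (p : Cell G × ℝ) : MTOP G.lineGraph :=
  @Classical.epsilon _ ⟨Pt.vertex p.1.e0⟩ (IsVal ν p)

variable {ν}

theorem Gap.rightCell_edges (g : Gap G) : (g.rightCell ν).edges = (g.right ν).edges := by
  unfold Gap.rightCell; split_ifs <;> simp

theorem step_edges_subset (p : Cell G × ℝ) : (Cell.step ν p).1.edges ⊆ p.1.edges := by
  obtain ⟨g | ⟨e, f, h⟩, s⟩ := p
  · simp only [Cell.step]
    split_ifs
    · exact g.left_edges_subset ν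
    · rw [g.rightCell_edges]; exact g.right_edges_subset ν
  · exact subset_rfl

theorem step_gap {g g' : Gap G} {s s' : ℝ} (h : Cell.step ν (Cell.gap g, s) = (Cell.gap g', s')) :
    Gap.Child ν g g' := by
  simp only [Cell.step] at h
  split_ifs at h with h1
  · exact Or.inl (Prod.mk.inj h).1
  · have h2 := (Prod.mk.inj h).1
    unfold Gap.rightCell at h2
    split_ifs at h2 with h3
    · refine Or.inr (Or.inr ⟨?_, h3⟩)
      cases hr : g.right ν with
      | gap g'' =>
        rw [hr] at h2
        injection h2 with h2
        rw [← h2]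
        rfl
      | edge e f h =>
        rw [hr] at h2
        cases h2
    · exact Or.inr (Or.inl ⟨h2, h3⟩)

theorem iterate_step_edge (e f : G.edgeSet) (h : G.lineGraph.Adj e f) (s : ℝ) (n : ℕ) :
    (Cell.step ν)^[n] (Cell.edge e f h, s) = (Cell.edge e f h, s) :=
  Function.iterate_fixed rfl n

theorem branch_of_forall_gap {p : Cell G × ℝ}
    (h : ∀ n e f h s, (Cell.step ν)^[n] p ≠ (Cell.edge e f h, s)) :
    ∃ s : ℕ → Gap G, (∀ n, Gap.Child ν (s n) (s (n + 1))) ∧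
      ∀ n, ((Cell.step ν)^[n] p).1 = Cell.gap (s n) := by
  have h1 : ∀ n, ∃ g, ((Cell.step ν)^[n] p).1 = Cell.gap g := by
    intro n
    rcases hc : (Cell.step ν)^[n] p with ⟨g | ⟨e, f, hh⟩, s⟩
    · exact ⟨g, rfl⟩
    · exact absurd hc (h n e f hh s)
  choose s hs using h1
  refine ⟨s, fun n => ?_, hs⟩
  refine step_gap (s := ((Cell.step ν)^[n] p).2) (s' := ((Cell.step ν)^[n + 1] p).2) ?_
  rw [← hs n, ← hs (n + 1), Function.iterate_succ_apply']

theorem exists_isVal (hν : Function.Injective ν) (p : Cell G × ℝ) : ∃ P, IsVal ν p P := by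
  by_cases h : ∃ n e f h s, (Cell.step ν)^[n] p = (Cell.edge e f h, s)
  · obtain ⟨n, e, f, h, s, hn⟩ := h
    exact ⟨_, Or.inl ⟨n, e, f, h, s, hn, rfl⟩⟩
  · push Not at h
    obtain ⟨s, hs, hs'⟩ := branch_of_forall_gap h
    obtain ⟨R, hR⟩ := Gap.exists_ray_of_branch hν hs
    refine ⟨_, Or.inr ⟨R, rfl, fun n => ?_⟩⟩
    rw [hs' n]
    exact hR n

theorem val_spec (hν : Function.Injective ν) (p : Cell G × ℝ) : IsVal ν p (val ν p) :=
  Classical.epsilon_spec_aux _ _ (exists_isVal hν p)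

theorem isVal_step (p : Cell G × ℝ) : IsVal ν (Cell.step ν p) = IsVal ν p := by
  funext P
  refine propext ⟨?_, ?_⟩
  · rintro (⟨n, e, f, h, s, hn, rfl⟩ | ⟨R, rfl, hR⟩)
    · exact Or.inl ⟨n + 1, e, f, h, s, hn, rfl⟩
    · refine Or.inr ⟨R, rfl, fun n => ?_⟩
      cases n with
      | zero => exact (hR 0).mono fun k hk => step_edges_subset p hk
      | succ n => exact hR n
  · rintro (⟨n, e, f, h, s, hn, rfl⟩ | ⟨R, rfl, hR⟩)
    · refine Or.inl ⟨n, e, f, h, s, ?_, rfl⟩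
      rw [← Function.iterate_succ_apply, Function.iterate_succ_apply', hn]
      rfl
    · exact Or.inr ⟨R, rfl, fun n => hR (n + 1)⟩

/-- The choice operator depends only on the predicate, and `p` and its successor have the same one.
Uniqueness of the limit point is not needed. -/
theorem val_step (p : Cell G × ℝ) : val ν (Cell.step ν p) = val ν p := by
  unfold val
  rw [isVal_step]

theorem val_iterate_step (n : ℕ) (p : Cell G × ℝ) : val ν ((Cell.step ν)^[n] p) = val ν p := by
  induction n with
  | zero => rfl
  | succ n ih => rw [Function.iterate_succ_apply', val_step, ih]

theorem val_edge (hν : Function.Injective ν) (e f : G.edgeSet) (h : G.lineGraph.Adj e f) (s : ℝ) :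
    val ν (Cell.edge e f h, s) = arc h s := by
  rcases val_spec hν (Cell.edge e f h, s) with ⟨n, e', f', h', s', hn, hv⟩ | ⟨R, -, hR⟩
  · rw [iterate_step_edge] at hn
    obtain ⟨h1, h2⟩ := Prod.mk.inj hn
    injection h1 with h3 h4
    subst h3 h4 h2
    exact hv
  · obtain ⟨k, hk⟩ := (hR 0).exists
    exact absurd hk (notMem_empty _)

theorem val_left (g : Gap G) {s : ℝ} (hs : s ≤ 1 / 2) :
    val ν (Cell.gap g, s) = val ν (g.left ν, 2 * s) := by
  rw [← val_step (Cell.gap g, s), Cell.step, if_pos hs]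

theorem val_right_of_lt (g : Gap G) {s : ℝ} (hs : 1 / 2 < s) :
    val ν (Cell.gap g, s) = val ν (g.rightCell ν, g.coord ν s) := by
  rw [← val_step (Cell.gap g, s), Cell.step, if_neg (not_le.2 hs)]

/-- A left child has `x = y`, so its own left cell is an edge of the line graph. Thus the parameter
`0` reaches an edge after at most two steps. -/
theorem val_zero (hν : Function.Injective ν) (c : Cell G) : val ν (c, 0) = Pt.vertex c.e0 := by
  cases c with
  | edge e f h => rw [val_edge hν, arc_zero]; rfl
  | gap g =>
    rw [val_left g (by norm_num), mul_zero]
    cases hl : g.left ν with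
    | edge e f h =>
      have h0 := g.left_e0 ν
      rw [hl] at h0
      rw [val_edge hν, arc_zero]
      exact congrArg Pt.vertex h0
    | gap g' =>
      obtain ⟨h1, h2, -⟩ := Gap.left_gap hl
      rw [val_left g' (by norm_num), mul_zero, Gap.left_of_x_eq_y h1, val_edge hν, arc_zero, h2]
      rfl

/-- Unreversed right cells bring the target closer, so only finitely many occur in succession before
an edge or a reversed cell is met. A reversal turns the parameter `1` into `0`. -/
theorem val_one (hν : Function.Injective ν) (c : Cell G) : val ν (c, 1) = Pt.vertex c.e1 := by
  cases c with
  | edge e f h => rw [val_edge hν, arc_one]; rfl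
  | gap g =>
    induction hd : g.dist ν using Nat.strong_induction_on generalizing g with
    | _ d ih =>
      subst hd
      rw [val_right_of_lt g (by norm_num)]
      by_cases hm : g.mid ν = g.target ν
      · rw [Gap.rightCell, if_pos hm, Gap.coord, if_pos hm]
        norm_num
        rw [val_zero hν, Cell.swap_e0, g.right_e1]
        rfl
      · rw [Gap.rightCell, if_neg hm, Gap.coord, if_neg hm]
        norm_num
        have h1 := g.right_e1 ν
        cases hr : g.right ν with
        | edge e f h =>
          rw [hr] at h1
          rw [val_edge hν, arc_one]
          exact congrArg Pt.vertex h1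
        | gap g' =>
          rw [hr] at h1
          rw [ih _ (Gap.right_gap_dist hν hr hm).2 g' rfl, h1]
          rfl

theorem val_half (hν : Function.Injective ν) (g : Gap G) :
    val ν (Cell.gap g, 1 / 2) = Pt.vertex (g.mid ν) := by
  rw [val_left g le_rfl]
  norm_num
  rw [val_one hν, g.left_e1]

/-- `Cell.step` assigns `1 / 2` to the left half. Both halves give the inserted edge there, so the
formula for the right half extends to its closure, as the gluing requires. -/
theorem val_right (hν : Function.Injective ν) (g : Gap G) {s : ℝ} (hs : 1 / 2 ≤ s) :
    val ν (Cell.gap g, s) = val ν (g.rightCell ν, g.coord ν s) := by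
  rcases hs.eq_or_lt with rfl | hs
  · rw [val_half hν]
    by_cases hm : g.mid ν = g.target ν
    · rw [Gap.rightCell, if_pos hm, Gap.coord, if_pos hm]
      norm_num
      rw [val_one hν, Cell.swap_e1, g.right_e0]
    · rw [Gap.rightCell, if_neg hm, Gap.coord, if_neg hm]
      norm_num
      rw [val_zero hν, g.right_e0]
  · exact val_right_of_lt g hs

theorem Gap.coord_mem_Icc (g : Gap G) {s : ℝ} (hs : s ∈ Icc (1 / 2 : ℝ) 1) :
    g.coord ν s ∈ Icc (0 : ℝ) 1 := by
  unfold Gap.coord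
  split_ifs <;> constructor <;> linarith [hs.1, hs.2]

theorem Gap.coord_mem_Ioo (g : Gap G) {s : ℝ} (hs : s ∈ Ioo (1 / 2 : ℝ) 1) :
    g.coord ν s ∈ Ioo (0 : ℝ) 1 := by
  unfold Gap.coord
  split_ifs <;> constructor <;> linarith [hs.1, hs.2]

theorem Gap.continuous_coord (g : Gap G) : Continuous (g.coord ν) := by
  unfold Gap.coord
  split_ifs <;> fun_prop

/-! ### The region of a cell -/

/-- The edges of the line graph that may be used inside a cell. -/
def Cell.arcs : Cell G → Set (Sym2 G.edgeSet)
  | Cell.gap g => {ε | (∃ a ∈ ε, a ∈ g.edges) ∧ ∀ a ∈ ε, a ∈ g.edges ∨ a = g.ex ∨ a = g.ey}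
  | Cell.edge e f _ => {s(e, f)}

/-- The points of `MTOP` that may be used inside a cell. -/
def Cell.region (c : Cell G) : Set (MTOP G.lineGraph) :=
  {p | match p with
    | Pt.vertex e => e ∈ c.edges
    | Pt.inner ε _ => (ε : Sym2 G.edgeSet) ∈ c.arcs
    | Pt.endPt ω => ∃ R : Ray G.lineGraph, VertexEnd.mk R = ω ∧
        ∀ᶠ k in atTop, R.vert k ∈ c.edges}

theorem Cell.swap_region (c : Cell G) : c.swap.region = c.region := by
  have h : c.swap.arcs = c.arcs := by
    cases c with
    | edge e f h => exact congrArg (fun x => ({x} : Set (Sym2 G.edgeSet))) Sym2.eq_swap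
    | gap g =>
      ext ε
      exact and_congr Iff.rfl (forall₂_congr fun a _ => or_congr Iff.rfl Or.comm)
  ext p
  rcases p with e | ⟨ε, t⟩ | ω
  · exact iff_of_eq (congrArg (e ∈ ·) c.swap_edges)
  · exact iff_of_eq (congrArg ((ε : Sym2 G.edgeSet) ∈ ·) h)
  · change (∃ R : Ray G.lineGraph, VertexEnd.mk R = ω ∧ ∀ᶠ k in atTop, R.vert k ∈ c.swap.edges) ↔
      ∃ R : Ray G.lineGraph, VertexEnd.mk R = ω ∧ ∀ᶠ k in atTop, R.vert k ∈ c.edges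
    rw [c.swap_edges]

theorem Cell.region_subset {c d : Cell G} (h1 : c.edges ⊆ d.edges) (h2 : c.arcs ⊆ d.arcs) :
    c.region ⊆ d.region := by
  rintro (e | ⟨ε, t⟩ | ω) hp
  · exact h1 hp
  · exact h2 hp
  · obtain ⟨R, hR, hR'⟩ := hp
    exact ⟨R, hR, hR'.mono fun k hk => h1 hk⟩

theorem Gap.left_region_subset (g : Gap G) : (g.left ν).region ⊆ (Cell.gap g).region := by
  refine Cell.region_subset (g.left_edges_subset ν) ?_
  have hsub := g.left_edges_subset ν
  have h0 := g.left_e0 ν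
  have h1 := g.left_e1 ν
  cases hl : g.left ν with
  | gap g' =>
    rw [hl] at hsub h0 h1
    have h1 : g'.ey = g.mid ν := h1
    rintro ε ⟨⟨a, ha, ha'⟩, hall⟩
    refine ⟨⟨a, ha, hsub ha'⟩, fun b hb => ?_⟩
    rcases hall b hb with h | rfl | rfl
    · exact Or.inl (hsub h)
    · exact Or.inr (Or.inl h0)
    · exact Or.inl (h1 ▸ g.mid_mem ν)
  | edge e f h =>
    rw [hl] at h0 h1
    have h1 : f = g.mid ν := h1
    rintro _ rfl
    refine ⟨⟨f, Sym2.mem_mk_right e f, h1 ▸ g.mid_mem ν⟩, fun b hb => ?_⟩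
    rcases Sym2.mem_iff.1 hb with rfl | rfl
    · exact Or.inr (Or.inl h0)
    · exact Or.inl (h1 ▸ g.mid_mem ν)

theorem Gap.right_region_subset (g : Gap G) : (g.right ν).region ⊆ (Cell.gap g).region := by
  refine Cell.region_subset (g.right_edges_subset ν) ?_
  have hsub := g.right_edges_subset ν
  have h0 := g.right_e0 ν
  have h1 := g.right_e1 ν
  cases hl : g.right ν with
  | gap g' =>
    rw [hl] at hsub h0 h1
    have h0 : g'.ex = g.mid ν := h0
    rintro ε ⟨⟨a, ha, ha'⟩, hall⟩
    refine ⟨⟨a, ha, hsub ha'⟩, fun b hb => ?_⟩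
    rcases hall b hb with h | rfl | rfl
    · exact Or.inl (hsub h)
    · exact Or.inl (h0 ▸ g.mid_mem ν)
    · exact Or.inr (Or.inr h1)
  | edge e f h =>
    rw [hl] at h0 h1
    have h0 : e = g.mid ν := h0
    rintro _ rfl
    refine ⟨⟨e, Sym2.mem_mk_left e f, h0 ▸ g.mid_mem ν⟩, fun b hb => ?_⟩
    rcases Sym2.mem_iff.1 hb with rfl | rfl
    · exact Or.inl (h0 ▸ g.mid_mem ν)
    · exact Or.inr (Or.inr h1)

theorem Gap.rightCell_region (g : Gap G) : (g.rightCell ν).region = (g.right ν).region := by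
  unfold Gap.rightCell
  split_ifs
  · exact Cell.swap_region _
  · rfl

theorem val_edge_mem_region (hν : Function.Injective ν) (e f : G.edgeSet)
    (h : G.lineGraph.Adj e f) {s : ℝ} (hs : s ∈ Ioo (0 : ℝ) 1) :
    val ν (Cell.edge e f h, s) ∈ (Cell.edge e f h).region := by
  rw [val_edge hν]
  obtain ⟨t, ht, -⟩ := arc_of_mem (Ω := VertexEnd G.lineGraph) h hs
  rw [ht]
  rfl

theorem val_mem_region (hν : Function.Injective ν) (c : Cell G) {s : ℝ} (hs : s ∈ Ioo (0 : ℝ) 1) :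
    val ν (c, s) ∈ c.region := by
  rcases val_spec hν (c, s) with ⟨n, e, f, h, s', hn, -⟩ | ⟨R, hv, hR⟩
  · induction n generalizing c s with
    | zero =>
      obtain ⟨rfl, rfl⟩ := Prod.mk.inj hn
      exact val_edge_mem_region hν e f h hs
    | succ n ih =>
      cases c with
      | edge e' f' h' => exact val_edge_mem_region hν e' f' h' hs
      | gap g =>
        rw [Function.iterate_succ_apply] at hn
        rcases lt_trichotomy s (1 / 2) with hlt | rfl | hgt
        · rw [Cell.step, if_pos hlt.le] at hn
          rw [val_left g hlt.le]
          exact g.left_region_subset (ih _ ⟨by linarith [hs.1], by linarith⟩ hn)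
        · rw [val_half hν]
          exact g.mid_mem ν
        · rw [Cell.step, if_neg (not_le.2 hgt)] at hn
          rw [val_right hν g hgt.le]
          have := ih _ (g.coord_mem_Ioo ⟨hgt, hs.2⟩) hn
          rw [g.rightCell_region] at this
          exact g.right_region_subset this
  · rw [hv]
    exact ⟨R, rfl, hR 0⟩

/-- The delicate case is that both cells are single edges of the line graph. They could coincide
only if `ex = ey`; but then `z = y`, and the field `loop` would identify `ex` with the inserted edge
`xz`. -/
theorem Gap.left_arcs_disjoint (g : Gap G) {ε : Sym2 G.edgeSet} (hε : ε ∈ G.lineGraph.edgeSet)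
    (hl : ε ∈ (g.left ν).arcs) (hr : ε ∈ (g.right ν).arcs) : False := by
  have hls := g.left_edges_subset ν
  have hrs := g.right_edges_subset ν
  have hlm := g.mid_notMem_left ν
  have hrm := g.mid_notMem_right ν
  have hl0 := g.left_e0 ν
  have hl1 := g.left_e1 ν
  have hr0 := g.right_e0 ν
  have hr1 := g.right_e1 ν
  have hd : ∀ a b, a ∈ (g.left ν).edges → b ∈ (g.right ν).edges → _ :=
    fun a b ha hb => left_right_disjoint ν ha hb
  have hbot : (∃ e f h, g.right ν = Cell.edge e f h) → rest g.C g.x (g.z ν) (g.z ν) = ⊥ := by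
    rintro ⟨e, f, h, heq⟩
    by_contra hne
    rw [Gap.right, dif_pos hne] at heq
    cases heq
  cases hcl : g.left ν with
  | gap g1 =>
    rw [hcl] at hl hls hlm hd
    obtain ⟨⟨a, ha, ha'⟩, -⟩ := hl
    cases hcr : g.right ν with
    | gap g2 =>
      rw [hcr] at hr hd
      obtain ⟨⟨b, hb, hb'⟩, -⟩ := hr
      obtain ⟨hab, hadj⟩ := hd a b ha' hb'
      rw [(Sym2.mem_and_mem_iff hab).1 ⟨ha, hb⟩] at hε
      exact hadj hε
    | edge e f h =>
      rw [hcr] at hr hr0 hr1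
      obtain rfl : ε = s(e, f) := hr
      obtain rfl : e = g.mid ν := hr0
      obtain rfl : f = g.ey := hr1
      rcases Sym2.mem_iff.1 ha with rfl | rfl
      · exact hlm ha'
      · exact g.ey_notMem_edges (hls ha')
  | edge e f h =>
    rw [hcl] at hl hl0 hl1
    obtain rfl : ε = s(e, f) := hl
    obtain rfl : e = g.ex := hl0
    obtain rfl : f = g.mid ν := hl1
    cases hcr : g.right ν with
    | gap g2 =>
      rw [hcr] at hr hrs hrm
      obtain ⟨⟨b, hb, hb'⟩, -⟩ := hr
      rcases Sym2.mem_iff.1 hb with rfl | rfl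
      · exact g.ex_notMem_edges (hrs hb')
      · exact hrm hb'
    | edge e' f' h' =>
      have hz := g.eq_of_rest_eq_bot (g.adj_z ν) (hbot ⟨e', f', h', hcr⟩)
      rw [hcr] at hr hr0 hr1
      obtain rfl : e' = g.mid ν := hr0
      obtain rfl : f' = g.ey := hr1
      have hr : s(g.ex, g.mid ν) = s(g.mid ν, g.ey) := hr
      have hee : g.ex = g.ey := by
        rcases Sym2.eq_iff.1 hr with ⟨h1, -⟩ | ⟨h1, -⟩
        · exact absurd h1 (g.ex_ne_mid ν)
        · exact h1
      have h1 := g.loop hee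
      rw [← hz] at h1
      exact g.ex_ne_mid ν (Subtype.ext h1)

theorem Gap.mem_edges_of_reachable (g : Gap G) {S : Set G.edgeSet}
    (hS : ∀ e f : G.edgeSet, (e : Sym2 V) ∈ g.C.edgeSet → G.lineGraph.Adj e f →
      f ∈ S ∨ (f : Sym2 V) ∈ g.C.edgeSet) {B : G.lineGraph.ComponentCompl S} {a b : G.edgeSet}
    (ha : a ∈ B) (hb : b ∈ B) (hag : a ∈ g.edges) : b ∈ g.edges := by
  obtain ⟨haS, ha⟩ := ha
  obtain ⟨hbS, hb⟩ := hb
  have hr : (G.lineGraph.induce Sᶜ).Reachable ⟨a, haS⟩ ⟨b, hbS⟩ :=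
    SimpleGraph.ConnectedComponent.exact (ha.trans hb.symm)
  have key : ∀ {u v : (Sᶜ : Set G.edgeSet)} (p : (G.lineGraph.induce Sᶜ).Walk u v),
      u.1 ∈ g.edges → v.1 ∈ g.edges := by
    intro u v p
    induction p with
    | nil => exact id
    | @cons u w v h p ih =>
      intro hu
      exact ih ((hS u.1 w.1 hu h).resolve_left w.2)
  obtain ⟨p⟩ := hr
  exact key p hag

/-- For ends, the finite separator of the left gap is decisive: a component of the line graph minus
this set that meets the left edges consists of left edges only, so no ray there is equivalent to a
ray on the right. -/
theorem Gap.disjoint_left_right (g : Gap G) {p : MTOP G.lineGraph} (hl : p ∈ (g.left ν).region)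
    (hr : p ∈ (g.right ν).region) : False := by
  rcases p with e | ⟨ε, t⟩ | ω
  · exact (left_right_disjoint ν hl hr).1 rfl
  · exact g.left_arcs_disjoint ε.2 hl hr
  · obtain ⟨R, hR, hRl⟩ := hl
    obtain ⟨R', hR', hRr⟩ := hr
    have hd : ∀ a b, a ∈ (g.left ν).edges → b ∈ (g.right ν).edges → a ≠ b :=
      fun a b ha hb => (left_right_disjoint ν ha hb).1
    cases hcl : g.left ν with
    | edge e f h =>
      rw [hcl] at hRl
      obtain ⟨k, hk⟩ := hRl.exists
      exact hk
    | gap g' =>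
      rw [hcl] at hRl hd
      obtain ⟨S, hS, hsep⟩ := g'.sep
      obtain ⟨B, hB, hB'⟩ := (Quotient.exact (hR.trans hR'.symm) :
        (vertexSetoid G.lineGraph).r R R') S hS
      obtain ⟨k, hk, hk'⟩ := (hB.and hRl).exists
      obtain ⟨j, hj, hj'⟩ := (hB'.and hRr).exists
      exact hd _ _ (g'.mem_edges_of_reachable hsep hk hj hk') hj' rfl

/-! ### Injectivity -/

/-- Each step doubles the distance of two parameters in the same half, so they are eventually
separated by a midpoint. Equality of the end edges is part of the conclusion for the sake of the
induction: the two subcells of a gap have distinct end edges, so coincidence within one of them is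
impossible. -/
theorem val_eq_of_expanding (hν : Function.Injective ν) (n : ℕ) :
    ∀ (c : Cell G) (s s' : ℝ), 0 ≤ s → s' ≤ 1 → s < s' → 1 < 2 ^ n * (s' - s) →
      val ν (c, s) = val ν (c, s') → s = 0 ∧ s' = 1 ∧ c.e0 = c.e1 := by
  induction n with
  | zero =>
    intro c s s' h0 h1 _ h3 _
    rw [pow_zero, one_mul] at h3
    linarith
  | succ n ih =>
    intro c s s' h0 h1 h2 h3 heq
    rw [pow_succ] at h3
    cases c with
    | edge e f h =>
      rw [val_edge hν, val_edge hν] at heq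
      have := arc_injOn h ⟨h0, by linarith⟩ ⟨by linarith, h1⟩ heq
      exact absurd this h2.ne
    | gap g =>
      rcases le_or_gt s' (1 / 2) with hs' | hs'
      · rw [val_left g hs', val_left g (by linarith)] at heq
        have := (ih _ _ _ (by linarith) (by linarith) (by linarith) (by linarith) heq).2.2
        rw [g.left_e0, g.left_e1] at this
        exact absurd this (g.ex_ne_mid ν)
      rcases le_or_gt (1 / 2) s with hs | hs
      · rw [val_right hν g hs, val_right hν g hs'.le] at heq
        by_cases hm : g.mid ν = g.target ν
        · simp only [Gap.rightCell, if_pos hm, Gap.coord] at heq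
          have := (ih _ _ _ (by linarith) (by linarith) (by linarith) (by linarith) heq.symm).2.2
          rw [Cell.swap_e0, Cell.swap_e1, g.right_e0, g.right_e1] at this
          exact absurd this.symm (g.mid_ne_ey ν)
        · simp only [Gap.rightCell, if_neg hm, Gap.coord] at heq
          have := (ih _ _ _ (by linarith) (by linarith) (by linarith) (by linarith) heq).2.2
          rw [g.right_e0, g.right_e1] at this
          exact absurd this (g.mid_ne_ey ν)
      -- Now `s < 1/2 < s'`. Each value is an end edge of the gap or lies in the region of its half;
      -- the two regions are disjoint and contain neither `ex` nor `ey`.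
      · have hl : s = 0 ∧ val ν (Cell.gap g, s) = Pt.vertex g.ex ∨
            val ν (Cell.gap g, s) ∈ (g.left ν).region := by
          rcases h0.eq_or_lt with rfl | h0
          · exact Or.inl ⟨rfl, val_zero hν _⟩
          · refine Or.inr ?_
            rw [val_left g hs.le]
            exact val_mem_region hν _ ⟨by linarith, by linarith⟩
        have hr : s' = 1 ∧ val ν (Cell.gap g, s') = Pt.vertex g.ey ∨
            val ν (Cell.gap g, s') ∈ (g.right ν).region := by
          rcases h1.eq_or_lt with rfl | h1
          · exact Or.inl ⟨rfl, val_one hν _⟩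
          · refine Or.inr ?_
            rw [val_right hν g hs'.le, ← g.rightCell_region]
            exact val_mem_region hν _ (g.coord_mem_Ioo ⟨hs', h1⟩)
        rcases hl with ⟨rfl, hl⟩ | hl <;> rcases hr with ⟨rfl, hr⟩ | hr
        · rw [hl, hr] at heq
          injection heq with heq
          exact ⟨rfl, rfl, heq⟩
        · rw [← heq, hl] at hr
          exact absurd (g.right_edges_subset ν hr) g.ex_notMem_edges
        · rw [heq, hr] at hl
          exact absurd (g.left_edges_subset ν hl) g.ey_notMem_edges
        · rw [heq] at hl
          exact (g.disjoint_left_right hl hr).elim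

theorem eq_of_val_eq (hν : Function.Injective ν) {c : Cell G} {s s' : ℝ} (h0 : 0 ≤ s) (h1 : s' ≤ 1)
    (h : s < s') (heq : val ν (c, s) = val ν (c, s')) : s = 0 ∧ s' = 1 := by
  obtain ⟨n, hn⟩ := pow_unbounded_of_one_lt (1 / (s' - s)) (one_lt_two (α := ℝ))
  have hpos : 0 < s' - s := sub_pos.2 h
  have := val_eq_of_expanding hν n c s s' h0 h1 h ((div_lt_iff₀ hpos).1 hn) heq
  exact ⟨this.1, this.2.1⟩

/-! ### Surjectivity onto the vertices of the line graph -/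

theorem exists_val_eq_vertex (hν : Function.Injective ν) (f : G.edgeSet) (g : Gap G) :
    f ∈ g.edges → ∃ s ∈ Ioo (0 : ℝ) 1, val ν (Cell.gap g, s) = Pt.vertex f := by
  induction g using (Gap.wellFounded_child hν f).induction with
  | _ g ih =>
    intro hf
    by_cases hm : f = g.mid ν
    · exact ⟨1 / 2, by norm_num, hm ▸ val_half hν g⟩
    rcases g.mem_left_or_right ν hf hm with h | h
    · cases hl : g.left ν with
      | edge e f h' =>
        rw [hl] at h
        exact absurd h (notMem_empty _)
      | gap g' =>
        rw [hl] at h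
        obtain ⟨s, hs, hv⟩ := ih g' ⟨Or.inl hl, h⟩ h
        refine ⟨s / 2, ⟨by linarith [hs.1], by linarith [hs.2]⟩, ?_⟩
        rw [val_left g (by linarith [hs.2]), hl, mul_div_cancel₀ s two_ne_zero, hv]
    · cases hr : g.right ν with
      | edge e f h' =>
        rw [hr] at h
        exact absurd h (notMem_empty _)
      | gap g' =>
        rw [hr] at h
        by_cases hmt : g.mid ν = g.target ν
        · obtain ⟨s, hs, hv⟩ := ih g'.swap ⟨Or.inr (Or.inr ⟨hr, hmt⟩), h⟩ h
          -- This inverts the reversed coordinate `2 - 2 * s` of the right half.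
          refine ⟨1 - s / 2, ⟨by linarith [hs.2], by linarith [hs.1]⟩, ?_⟩
          rw [val_right hν g (by linarith [hs.2]), Gap.rightCell, if_pos hmt, Gap.coord,
            if_pos hmt, hr, ← hv]
          congr 2
          ring
        · obtain ⟨s, hs, hv⟩ := ih g' ⟨Or.inr (Or.inl ⟨hr, hmt⟩), h⟩ h
          refine ⟨(s + 1) / 2, ⟨by linarith [hs.1], by linarith [hs.2]⟩, ?_⟩
          rw [val_right hν g (by linarith [hs.1]), Gap.rightCell, if_neg hmt, Gap.coord,
            if_neg hmt, hr, ← hv]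
          congr 2
          ring

end LimitMap

/-! ### Continuity -/

section Continuity

variable {G : SimpleGraph V} {ν : G.edgeSet → ℕ}

/-- Continuity of the limit map at a point of a cell. -/
def ContAt (ν : G.edgeSet → ℕ) (p : Cell G × ℝ) : Prop :=
  ContinuousWithinAt (fun s => val ν (p.1, s)) (Icc 0 1) p.2

theorem contAt_edge (hν : Function.Injective ν) (e f : G.edgeSet) (h : G.lineGraph.Adj e f) (s : ℝ) :
    ContAt ν (Cell.edge e f h, s) := by
  unfold ContAt
  simp only [val_edge hν]
  exact (continuous_arc h).continuousWithinAt

theorem contWithin_left (g : Gap G) {s : ℝ} (hs : s ≤ 1 / 2)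
    (h : ContAt ν (g.left ν, 2 * s)) :
    ContinuousWithinAt (fun s => val ν (Cell.gap g, s)) (Icc 0 (1 / 2)) s := by
  have h1 : ContinuousWithinAt ((fun s => val ν (g.left ν, s)) ∘ fun s => 2 * s)
      (Icc 0 (1 / 2)) s := by
    refine ContinuousWithinAt.comp (t := Icc 0 1) h (by fun_prop) fun r hr => ?_
    exact ⟨by linarith [hr.1], by linarith [hr.2]⟩
  exact h1.congr (fun r hr => val_left g hr.2) (val_left g hs)

theorem contWithin_right (hν : Function.Injective ν) (g : Gap G) {s : ℝ} (hs : 1 / 2 ≤ s)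
    (h : ContAt ν (g.rightCell ν, g.coord ν s)) :
    ContinuousWithinAt (fun s => val ν (Cell.gap g, s)) (Icc (1 / 2) 1) s := by
  have h1 : ContinuousWithinAt ((fun s => val ν (g.rightCell ν, s)) ∘ g.coord ν)
      (Icc (1 / 2) 1) s :=
    ContinuousWithinAt.comp (t := Icc 0 1) h g.continuous_coord.continuousWithinAt
      fun r hr => g.coord_mem_Icc hr
  exact h1.congr (fun r hr => val_right hν g hr.1) (val_right hν g hs)

theorem contAt_of_left (g : Gap G) {s : ℝ} (hs : s < 1 / 2) (h : ContAt ν (g.left ν, 2 * s)) :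
    ContAt ν (Cell.gap g, s) := by
  refine (contWithin_left g hs.le h).mono_of_mem_nhdsWithin ?_
  filter_upwards [self_mem_nhdsWithin, mem_nhdsWithin_of_mem_nhds (Iio_mem_nhds hs)] with r hr hr'
  exact ⟨hr.1, le_of_lt hr'⟩

theorem contAt_of_right (hν : Function.Injective ν) (g : Gap G) {s : ℝ} (hs : 1 / 2 < s)
    (h : ContAt ν (g.rightCell ν, g.coord ν s)) : ContAt ν (Cell.gap g, s) := by
  refine (contWithin_right hν g hs.le h).mono_of_mem_nhdsWithin ?_
  filter_upwards [self_mem_nhdsWithin, mem_nhdsWithin_of_mem_nhds (Ioi_mem_nhds hs)] with r hr hr'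
  exact ⟨le_of_lt hr', hr.2⟩

theorem contAt_zero (hν : Function.Injective ν) (c : Cell G) : ContAt ν (c, 0) := by
  cases c with
  | edge e f h => exact contAt_edge hν e f h 0
  | gap g =>
    refine contAt_of_left g (by norm_num) ?_
    rw [mul_zero]
    cases hl : g.left ν with
    | edge e f h => exact contAt_edge hν e f h 0
    | gap g' =>
      refine contAt_of_left g' (by norm_num) ?_
      rw [Gap.left_of_x_eq_y (Gap.left_gap hl).1]
      exact contAt_edge hν _ _ _ _

theorem contAt_one (hν : Function.Injective ν) (c : Cell G) : ContAt ν (c, 1) := by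
  cases c with
  | edge e f h => exact contAt_edge hν e f h 1
  | gap g =>
    induction hd : g.dist ν using Nat.strong_induction_on generalizing g with
    | _ d ih =>
      subst hd
      refine contAt_of_right hν g (by norm_num) ?_
      by_cases hm : g.mid ν = g.target ν
      · have h0 : g.coord ν 1 = 0 := by rw [Gap.coord, if_pos hm]; norm_num
        rw [h0]
        exact contAt_zero hν _
      · have h1 : g.coord ν 1 = 1 := by rw [Gap.coord, if_neg hm]; norm_num
        rw [h1, Gap.rightCell, if_neg hm]
        cases hr : g.right ν with
        | edge e f h => exact contAt_edge hν e f h 1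
        | gap g' => exact ih _ (Gap.right_gap_dist hν hr hm).2 g' rfl

/-- Away from `1/2` the step is locally one affine map into one cell. At `1/2` the one-sided
continuities come from the ends of the two subcells, where continuity is already known. -/
theorem contAt_of_step (hν : Function.Injective ν) (c : Cell G) {s : ℝ} (hs : s ∈ Icc (0 : ℝ) 1)
    (h : ContAt ν (Cell.step ν (c, s))) : ContAt ν (c, s) := by
  cases c with
  | edge e f h' => exact contAt_edge hν e f h' s
  | gap g =>
    rcases lt_trichotomy s (1 / 2) with hlt | rfl | hgt
    · rw [Cell.step, if_pos hlt.le] at h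
      exact contAt_of_left g hlt h
    · have h1 : ContAt ν (g.left ν, 2 * (1 / 2)) := by
        rw [mul_one_div_cancel two_ne_zero]
        exact contAt_one hν _
      have h2 : ContAt ν (g.rightCell ν, g.coord ν (1 / 2)) := by
        by_cases hm : g.mid ν = g.target ν
        · have : g.coord ν (1 / 2) = 1 := by rw [Gap.coord, if_pos hm]; norm_num
          rw [this]
          exact contAt_one hν _
        · have : g.coord ν (1 / 2) = 0 := by rw [Gap.coord, if_neg hm]; norm_num
          rw [this]
          exact contAt_zero hν _
      have h3 := (contWithin_left g le_rfl h1).union (contWithin_right hν g le_rfl h2)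
      rw [Icc_union_Icc_eq_Icc (by norm_num) (by norm_num)] at h3
      exact h3
    · rw [Cell.step, if_neg (not_le.2 hgt)] at h
      exact contAt_of_right hν g hgt h

theorem step_mem_Icc (p : Cell G × ℝ) (hp : p.2 ∈ Icc (0 : ℝ) 1) :
    (Cell.step ν p).2 ∈ Icc (0 : ℝ) 1 := by
  obtain ⟨g | ⟨e, f, h⟩, s⟩ := p
  · simp only [Cell.step]
    split_ifs with h
    · exact ⟨by linarith [hp.1], by linarith⟩
    · exact g.coord_mem_Icc ⟨(not_le.1 h).le, hp.2⟩
  · exact hp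

theorem iterate_step_mem_Icc (p : Cell G × ℝ) (hp : p.2 ∈ Icc (0 : ℝ) 1) (n : ℕ) :
    ((Cell.step ν)^[n] p).2 ∈ Icc (0 : ℝ) 1 := by
  induction n with
  | zero => exact hp
  | succ n ih => rw [Function.iterate_succ_apply']; exact step_mem_Icc _ ih

theorem contAt_of_iterate (hν : Function.Injective ν) (n : ℕ) (p : Cell G × ℝ)
    (hp : p.2 ∈ Icc (0 : ℝ) 1) (h : ContAt ν ((Cell.step ν)^[n] p)) : ContAt ν p := by
  induction n generalizing p with
  | zero => exact h
  | succ n ih =>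
    rw [Function.iterate_succ_apply] at h
    exact contAt_of_step hν p.1 hp (ih _ (step_mem_Icc p hp) h)

/-- The points close to an inner point of a cell lie in the same cells of the subdivisions. -/
theorem eventually_iterate_step (n : ℕ) (c : Cell G) (s : ℝ)
    (h : ∀ k ≤ n, ((Cell.step ν)^[k] (c, s)).2 ∈ Ioo (0 : ℝ) 1) :
    ∀ᶠ s' in 𝓝 s, ((Cell.step ν)^[n] (c, s')).1 = ((Cell.step ν)^[n] (c, s)).1 ∧
      ((Cell.step ν)^[n] (c, s')).2 ∈ Ioo (0 : ℝ) 1 := by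
  induction n generalizing c s with
  | zero =>
    have h0 := h 0 le_rfl
    filter_upwards [isOpen_Ioo.mem_nhds h0] with s' hs'
    exact ⟨rfl, hs'⟩
  | succ n ih =>
    cases c with
    | edge e f h' =>
      have h0 := h 0 (Nat.zero_le _)
      filter_upwards [isOpen_Ioo.mem_nhds h0] with s' hs'
      rw [iterate_step_edge, iterate_step_edge]
      exact ⟨rfl, hs'⟩
    | gap g =>
      simp only [Function.iterate_succ_apply]
      have h' : ∀ k ≤ n, ((Cell.step ν)^[k] (Cell.step ν (Cell.gap g, s))).2 ∈ Ioo (0 : ℝ) 1 :=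
        fun k hk => h (k + 1) (by omega)
      rcases lt_trichotomy s (1 / 2) with hlt | rfl | hgt
      · have hst : ∀ r : ℝ, r ≤ 1 / 2 → Cell.step ν (Cell.gap g, r) = (g.left ν, 2 * r) :=
          fun r hr => by rw [Cell.step, if_pos hr]
        rw [hst s hlt.le] at h' ⊢
        have ht : Tendsto (fun r : ℝ => 2 * r) (𝓝 s) (𝓝 (2 * s)) :=
          (by fun_prop : Continuous fun r : ℝ => 2 * r).tendsto s
        filter_upwards [ht.eventually (ih _ _ h'), Iio_mem_nhds hlt] with r hr hr'
        rw [hst r (le_of_lt hr')]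
        exact hr
      -- The midpoint is sent to the end `1` of the left cell, which the hypothesis excludes.
      · have h1 := h' 0 (Nat.zero_le _)
        rw [Function.iterate_zero_apply, Cell.step, if_pos le_rfl] at h1
        have := h1.2
        norm_num at this
      · have hst : ∀ r : ℝ, 1 / 2 < r →
            Cell.step ν (Cell.gap g, r) = (g.rightCell ν, g.coord ν r) :=
          fun r hr => by rw [Cell.step, if_neg (not_le.2 hr)]
        rw [hst s hgt] at h' ⊢
        have ht : Tendsto (g.coord ν) (𝓝 s) (𝓝 (g.coord ν s)) := g.continuous_coord.tendsto s
        filter_upwards [ht.eventually (ih _ _ h'), Ioi_mem_nhds hgt] with r hr hr'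
        rw [hst r hr']
        exact hr

theorem Gap.edges_subset_component (g : Gap G) {S : Set G.edgeSet} (hS : Disjoint g.edges S)
    {B : G.lineGraph.ComponentCompl S} {a : G.edgeSet} (ha : a ∈ g.edges) (haB : a ∈ B)
    {b : G.edgeSet} (hb : b ∈ g.edges) : b ∈ B := by
  have h := g.edges_connected ha hb
  induction h with
  | refl => exact haB
  | tail _ h ih =>
    exact SimpleGraph.ComponentCompl.mem_of_adj _ _ (ih h.2.1) (Set.disjoint_left.1 hS h.2.2) h.1

/-- A region all of whose arcs run inside a component is contained in the corresponding basic
open set. -/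
theorem Gap.region_subset_mtopBasic {g : Gap G} {S : Set G.edgeSet}
    {B : G.lineGraph.ComponentCompl S} (hg : ∀ e ∈ g.edges, e ∈ B) (hx : g.ex ∈ B) (hy : g.ey ∈ B)
    (ε : ℝ) : (Cell.gap g).region ⊆ mtopBasic G.lineGraph S B ε := by
  rintro (e | ⟨α, t⟩ | ω) hp
  · exact hg e hp
  · refine Or.inl fun a ha => ?_
    rcases hp.2 a ha with h | rfl | rfl
    exacts [hg a h, hx, hy]
  · obtain ⟨R, hR, hR'⟩ := hp
    exact ⟨R, hR, hR'.mono fun k hk => hg _ hk⟩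

/-- A finite set `S` is eventually disjoint from the edges of the gaps, which then lie in one
component of the line graph minus `S`, by connectedness. Nearby parameters take their values in the
region of a late gap, hence in the given neighbourhood. -/
theorem contAt_of_branch (hν : Function.Injective ν) {p : Cell G × ℝ} {g : ℕ → Gap G}
    (hg : ∀ n, Gap.Child ν (g n) (g (n + 1)))
    (hpg : ∀ n, ((Cell.step ν)^[n] p).1 = Cell.gap (g n))
    (hp : ∀ n, ((Cell.step ν)^[n] p).2 ∈ Ioo (0 : ℝ) 1) : ContAt ν p := by
  obtain ⟨R, hv, hR⟩ : ∃ R : Ray G.lineGraph, val ν p = Pt.endPt (VertexEnd.mk R) ∧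
      ∀ n, ∀ᶠ k in atTop, R.vert k ∈ (g n).edges := by
    rcases val_spec hν p with ⟨n, e, f, h, s, hn, -⟩ | ⟨R, hv, hR⟩
    · have := hpg n
      rw [hn] at this
      cases this
    · refine ⟨R, hv, fun n => ?_⟩
      have := hR n
      rw [hpg n] at this
      exact this
  refine tendsto_nhdsWithin_of_tendsto_nhds ?_
  change Tendsto _ _ (𝓝 (val ν p))
  rw [TopologicalSpace.tendsto_nhds_generateFrom_iff]
  rintro U ((⟨e, I, hI, rfl⟩ | ⟨v, ε, h0, h1, rfl⟩) | ⟨S, R', B, ε, hS, hR', h0, h1, rfl⟩) hmem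
  · rw [hv] at hmem
    obtain ⟨t, -, ht⟩ := hmem
    cases ht
  · rw [hv] at hmem
    exact hmem.elim
  · rw [hv] at hmem
    obtain ⟨R₁, hR₁, hR₁B⟩ := hmem
    have hRB : R.TailInV B := by
      obtain ⟨D, hD, hD'⟩ := (Quotient.exact hR₁ : (vertexSetoid G.lineGraph).r R₁ R) S hS
      rwa [R₁.tailInV_unique hR₁B hD]
    obtain ⟨n, hn⟩ : ∃ n, Disjoint (g n).edges S := by
      choose N hN using Gap.exists_notMem_of_branch hν hg
      obtain ⟨m, hm⟩ := (hS.image N).bddAbove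
      refine ⟨m, Set.disjoint_left.2 fun e he heS => hN e ?_⟩
      exact Gap.edges_antitone hg (hm ⟨e, heS, rfl⟩) he
    obtain ⟨k, hk, hk'⟩ := ((hR n).and hRB).exists
    have hsub : ∀ e ∈ (g n).edges, e ∈ B := fun e he => (g n).edges_subset_component hn hk hk' he
    -- Arcs in a gap may run to its end edges, which need not lie in `B` at stage `n`. At stage `m`
    -- both have been replaced by edges inserted after stage `n`, so whole arcs lie in `B` and no
    -- restriction by `ε` arises.
    obtain ⟨m, hnm, hmx, hmy⟩ := Gap.exists_ends_mem hν hg n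
    filter_upwards [eventually_iterate_step m p.1 p.2 fun k _ => hp k] with s hs
    have h3 := val_mem_region hν ((Cell.step ν)^[m] (p.1, s)).1 hs.2
    have h4 : ((Cell.step ν)^[m] (p.1, s)).1 = Cell.gap (g m) := hs.1.trans (hpg m)
    rw [mem_preimage, ← val_iterate_step m]
    refine Gap.region_subset_mtopBasic (g := g m)
      (fun e he => hsub e (Gap.edges_antitone hg hnm he)) (hsub _ hmx) (hsub _ hmy) ε ?_
    rw [← h4]
    exact h3

/-- The parameter reaches an edge of the line graph, or an end of some cell, or stays in the
interior of nested gaps forever; one continuity lemma covers each case. -/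
theorem continuousOn_val (hν : Function.Injective ν) (c : Cell G) :
    ContinuousOn (fun s => val ν (c, s)) (Icc 0 1) := by
  intro s hs
  change ContAt ν (c, s)
  by_cases h : ∃ n e f h s', (Cell.step ν)^[n] (c, s) = (Cell.edge e f h, s')
  · obtain ⟨n, e, f, h, s', hn⟩ := h
    exact contAt_of_iterate hν n _ hs (hn ▸ contAt_edge hν e f h s')
  push Not at h
  obtain ⟨g, hg, hpg⟩ := branch_of_forall_gap h
  by_cases hend : ∃ n, ((Cell.step ν)^[n] (c, s)).2 ∉ Ioo (0 : ℝ) 1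
  · obtain ⟨n, hn⟩ := hend
    have hI := iterate_step_mem_Icc (ν := ν) (c, s) hs n
    refine contAt_of_iterate hν n _ hs ?_
    rcases hq : (Cell.step ν)^[n] (c, s) with ⟨d, r⟩
    rw [hq] at hn hI
    rcases hI.1.eq_or_lt with h0 | h0
    · obtain rfl : 0 = r := h0
      exact contAt_zero hν d
    rcases hI.2.eq_or_lt with h1 | h1
    · obtain rfl : r = 1 := h1
      exact contAt_one hν d
    · exact absurd ⟨h0, h1⟩ hn
  · push Not at hend
    exact contAt_of_branch hν hg hpg hend

end Continuity

/-! ### The Hamilton circle -/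

/-- The gap that remains after choosing a first edge. -/
theorem exists_initial_gap {G : SimpleGraph V} {u v : V} (huv : G.Adj u v)
    (heven : ∀ w, EvenCuts G w w) (hconn : ∀ a b, G.Adj a b → G.Reachable u a) :
    ∃ g : Gap G, g.ex = ⟨s(u, v), huv⟩ ∧ g.ey = ⟨s(u, v), huv⟩ ∧
      ∀ e : G.edgeSet, e ≠ ⟨s(u, v), huv⟩ → e ∈ g.edges := by
  -- Since all finite cuts are even, `uv` is not a bridge: deleting it leaves the parity condition
  -- from `v` to `u`, which forces these to stay connected.
  have hcut := (heven u).deleteEdge huv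
  have hreach : ∀ {a b : V} (p : G.Walk a b), (G.deleteEdges {s(u, v)}).Reachable a b := by
    intro a b p
    induction p with
    | nil => exact SimpleGraph.Reachable.refl _
    | @cons a c b h p ih =>
      by_cases hac : s(a, c) = s(u, v)
      · rcases Sym2.eq_iff.1 hac with ⟨rfl, rfl⟩ | ⟨rfl, rfl⟩
        · exact hcut.reachable.symm.trans ih
        · exact hcut.reachable.trans ih
      · have : (G.deleteEdges {s(u, v)}).Adj a c := SimpleGraph.deleteEdges_adj.2 ⟨h, hac⟩
        exact this.reachable.trans ih
  have hmem : s(u, v) ∉ (G.deleteEdges {s(u, v)}).edgeSet := by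
    rw [SimpleGraph.edgeSet_deleteEdges]
    exact fun h => h.2 rfl
  refine ⟨{ C := G.deleteEdges {s(u, v)}
            x := v
            y := u
            ex := ⟨s(u, v), huv⟩
            ey := ⟨s(u, v), huv⟩
            le := SimpleGraph.deleteEdges_le _
            x_mem := Sym2.mem_mk_right u v
            y_mem := Sym2.mem_mk_left u v
            ex_notMem := hmem
            ey_notMem := hmem
            conn := fun a b h => ?_
            ne_bot := fun hb => ?_
            even := hcut
            loop := fun _ => Sym2.eq_swap
            sep := ⟨{⟨s(u, v), huv⟩}, finite_singleton _, fun e f _ _ => ?_⟩ }, rfl, rfl,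
            fun e he => ?_⟩
  · obtain ⟨p⟩ := hconn a b (SimpleGraph.deleteEdges_le _ h)
    exact hcut.reachable.trans (hreach p)
  · have := hcut.reachable
    rw [hb] at this
    exact huv.ne (SimpleGraph.reachable_bot.1 this).symm
  · by_cases hf : f = ⟨s(u, v), huv⟩
    · exact Or.inl hf
    · right
      rw [SimpleGraph.edgeSet_deleteEdges]
      exact ⟨f.2, fun h => hf (Subtype.ext h)⟩
  · change (e : Sym2 V) ∈ (G.deleteEdges {s(u, v)}).edgeSet
    rw [SimpleGraph.edgeSet_deleteEdges]
    exact ⟨e.2, fun h => he (Subtype.ext h)⟩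

/-- A closed curve that is injective up to its endpoints traces out a circle. -/
theorem isCircle_image_Icc {X : Type u} [TopologicalSpace X] [T2Space X] {f : ℝ → X}
    (hf : ContinuousOn f (Icc 0 1)) (h01 : f 0 = f 1)
    (hinj : ∀ s s', 0 ≤ s → s' ≤ 1 → s < s' → f s = f s' → s = 0 ∧ s' = 1) :
    IsCircle (f '' Icc 0 1) := by
  have : Fact ((0 : ℝ) < 1) := ⟨one_pos⟩
  let φ : AddCircle (1 : ℝ) → X := AddCircle.liftIco 1 0 f
  have hφ : ∀ s ∈ Ico (0 : ℝ) 1, φ s = f s := fun s hs =>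
    AddCircle.liftIco_coe_apply (by rwa [zero_add])
  have hc : Continuous φ := AddCircle.liftIco_continuous (by rwa [zero_add]) (by rwa [zero_add])
  have hrep : ∀ x : AddCircle (1 : ℝ), ∃ s ∈ Ico (0 : ℝ) 1, (s : AddCircle (1 : ℝ)) = x := by
    intro x
    have := (AddCircle.coe_image_Ico_eq (1 : ℝ) 0).symm ▸ mem_univ x
    rwa [zero_add] at this
  have hi : Function.Injective φ := by
    intro x y hxy
    obtain ⟨s, hs, rfl⟩ := hrep x
    obtain ⟨t, ht, rfl⟩ := hrep y
    rw [hφ s hs, hφ t ht] at hxy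
    rcases lt_trichotomy s t with h | rfl | h
    · exact absurd (hinj s t hs.1 ht.2.le h hxy).2 ht.2.ne
    · rfl
    · exact absurd (hinj t s ht.1 hs.2.le h hxy.symm).2 hs.2.ne
  have hr : range φ = f '' Icc 0 1 := by
    ext p
    constructor
    · rintro ⟨x, rfl⟩
      obtain ⟨s, hs, rfl⟩ := hrep x
      exact ⟨s, Ico_subset_Icc_self hs, (hφ s hs).symm⟩
    · rintro ⟨s, hs, rfl⟩
      rcases hs.2.eq_or_lt with rfl | h1
      · exact ⟨((0 : ℝ) : AddCircle (1 : ℝ)), (hφ 0 (by norm_num)).trans h01⟩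
      · exact ⟨s, hφ s ⟨hs.1, h1⟩⟩
  rw [← hr]
  exact ⟨(AddCircle.homeomorphCircle one_ne_zero).symm.trans
    (hc.isClosedEmbedding hi).isEmbedding.toHomeomorph⟩

theorem exists_isHamiltonCircle [Countable V] {G : SimpleGraph V} (hG : G.edgeSet.Nonempty)
    {σ : Circle → ETOP G} (hσ : IsTopologicalEulerTour G σ) :
    ∃ H : Set (MTOP G.lineGraph), IsHamiltonCircle G.lineGraph H := by
  obtain ⟨e₀, he₀⟩ := hG
  induction e₀ using Sym2.ind with
  | _ u v =>
    have : Countable (Sym2 V) := Quot.mk_surjective.countable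
    obtain ⟨ν, hν⟩ := Countable.exists_injective_nat G.edgeSet
    obtain ⟨g, hx, hy, hall⟩ := exists_initial_gap he₀ hσ.evenCuts
      fun a b h => hσ.reachable he₀ h
    have h0 := val_zero hν (Cell.gap g)
    have h1 := val_one hν (Cell.gap g)
    -- The initial gap both starts and ends at the edge `uv` of `G`, so the curve closes up at that
    -- vertex of the line graph.
    refine ⟨(fun s => val ν (Cell.gap g, s)) '' Icc 0 1,
      isCircle_image_Icc (continuousOn_val hν _) ?_ fun s s' => eq_of_val_eq hν, fun e => ?_⟩
    · rw [h0, h1]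
      exact congrArg Pt.vertex (hx.trans hy.symm)
    · by_cases he : e = ⟨s(u, v), he₀⟩
      · refine ⟨0, by norm_num, h0.trans ?_⟩
        rw [he]
        exact congrArg Pt.vertex hx
      · obtain ⟨s, hs, hv⟩ := exists_val_eq_vertex hν e g (hall e he)
        exact ⟨s, Ioo_subset_Icc_self hs, hv⟩

end InfGraph

theorem theorem1p4 {V : Type u} [Countable V] (G : SimpleGraph V) (hG : G.edgeSet.Nonempty)
    (hE : ∃ σ : Circle → InfGraph.ETOP G, InfGraph.IsTopologicalEulerTour G σ) :
    ∃ H : Set (InfGraph.MTOP G.lineGraph), InfGraph.IsHamiltonCircle G.lineGraph H := by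
  obtain ⟨σ, hσ⟩ := hE
  exact InfGraph.exists_isHamiltonCircle hG hσ
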